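/- Let $\mathcal X$ be a real Banach space with its Borel $\sigma$-algebra, and let $\mu$ be a Borel probability measure on $\mathcal X$ that is concentrated on a separable set (this is automatic if $\mathcal X$ is separable). Let $C>0$, and suppose that $\mu$ satisfies the log-Sobolev inequality with constant $C$: $$\int f^2\log f^2\,d\mu-\Big(\int f^2\,d\mu\Big)\log\Big(\int f^2\,d\mu\Big)\le 2C\int\|\nabla f\|^2\,d\mu$$ for all smooth ($C^\infty$) functions $f:\mathcal X\to\mathbb R$ such that $f^2$, $f^2\log f^2$ and $\|\nabla f\|^2$ are $\mu$-integrable, where $0\log 0=0$ and $$\|\nabla f(x)\|=\sup_{y\ne0}\lim_{t\downarrow0}\frac{|f(x+ty)-f(x)|}{t\|y\|}$$ (understood as $0$ if $\mathcal X=\{0\}$). Let $p\in[1,\infty)$ and let $$W_p(\nu,\nu')=\inf_{\xi}\Big[\int\|x-y\|^p\,d\xi(x,y)\Big]^{1/p}\in[0,\infty]$$ be the Wasserstein distance of order $p$, the infimum being over all measures $\xi$ on $\mathcal X^2$ with marginals $\nu$ and $\nu'$. Let $n\ge1$, let $X_1,\dots,X_n$ be independent random variables with law $\mu$, and let $\hat\mu=\frac1n\sum_{i=1}^n\delta_{X_i}$.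 Then $W_p(\hat\mu,\mu)$ is finite and has finite expectation, and for every $t\ge0$ $$\mathbb P\big[W_p(\hat\mu,\mu)-\mathbb E\,W_p(\hat\mu,\mu)\ge t\big]\le\exp\Big(-\frac{n^{2/(2\vee p)}\,t^2}{2C}\Big),\qquad 2\vee p=\max\{2,p\}.$$ -/

import Mathlib

open MeasureTheory ProbabilityTheory Filter Topology
open scoped ENNReal

noncomputable section

namespace EmpiricalWasserstein

/-- `ξ` is a coupling of `μ` and `ν`: a measure on the product with marginals `μ` and `ν`. -/
def IsCoupling {E : Type*} [NormedAddCommGroup E] [MeasurableSpace E]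
    (ξ : Measure (E × E)) (μ ν : Measure E) : Prop :=
  ξ.map Prod.fst = μ ∧ ξ.map Prod.snd = ν

/-- The Wasserstein distance of order `p` for the norm distance, with values in `[0, ∞]`:
`inf_ξ (∫ ‖x - y‖ ^ p dξ(x, y)) ^ (1 / p)`, the infimum over all couplings `ξ`. -/
def wasserstein {E : Type*} [NormedAddCommGroup E] [MeasurableSpace E]
    (p : ℝ) (μ ν : Measure E) : ℝ≥0∞ :=
  ⨅ (ξ : Measure (E × E)) (_ : IsCoupling ξ μ ν), (∫⁻ z, ‖z.1 - z.2‖ₑ ^ p ∂ξ) ^ (1 / p)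

/-- The empirical measure of the sample points `x 0, …, x (n - 1)`, with mass `1 / n` at each. -/
def empiricalMeasure {E : Type*} [MeasurableSpace E] {n : ℕ} (x : Fin n → E) : Measure E :=
  (n : ℝ≥0∞)⁻¹ • ∑ i, Measure.dirac (x i)

/-- `sup_y lim_{t ↓ 0} |f (x + t y) - f x| / (t ‖y‖)` (the direction `y = 0` contributes `0`). -/
def gradNorm {E : Type*} [NormedAddCommGroup E] [NormedSpace ℝ E] (f : E → ℝ) (x : E) : ℝ :=
  ⨆ y : E, limUnder (𝓝[>] (0 : ℝ)) (fun t : ℝ => |f (x + t • y) - f x| / (t * ‖y‖))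

theorem gradNorm_eq_norm_fderiv {E : Type*} [NormedAddCommGroup E] [NormedSpace ℝ E]
    {f : E → ℝ} {x : E} (hf : DifferentiableAt ℝ f x) : gradNorm f x = ‖fderiv ℝ f x‖ := by
  have key : ∀ y : E, limUnder (𝓝[>] (0 : ℝ))
      (fun t : ℝ => |f (x + t • y) - f x| / (t * ‖y‖)) = |fderiv ℝ f x y| / ‖y‖ := by
    intro y
    apply Tendsto.limUnder_eq
    have h1 : HasDerivAt (fun t : ℝ => f (x + t • y)) (fderiv ℝ f x y) 0 :=
      hf.hasFDerivAt.hasLineDerivAt y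
    have h2 := h1.tendsto_slope_zero_right
    have h3 := (h2.abs).div_const ‖y‖
    refine h3.congr' ?_
    filter_upwards [self_mem_nhdsWithin] with t ht
    have ht' : (0 : ℝ) < t := ht
    simp only [zero_add, zero_smul, add_zero, smul_eq_mul, abs_mul, abs_inv, abs_of_pos ht']
    rw [div_mul_eq_div_div, inv_mul_eq_div]
  have hle : ∀ y : E, |fderiv ℝ f x y| / ‖y‖ ≤ ‖fderiv ℝ f x‖ := fun y =>
    (fderiv ℝ f x).ratio_le_opNorm y
  unfold gradNorm
  simp only [key]
  apply le_antisymm (ciSup_le hle)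
  have hb : BddAbove (Set.range fun y : E => |fderiv ℝ f x y| / ‖y‖) :=
    ⟨_, by rintro _ ⟨y, rfl⟩; exact hle y⟩
  refine ContinuousLinearMap.opNorm_le_bound _ ?_ fun y => ?_
  · exact le_ciSup_of_le hb 0 (by simp)
  · rcases eq_or_ne y 0 with rfl | hy
    · simp
    · rw [Real.norm_eq_abs, ← div_le_iff₀ (norm_pos_iff.mpr hy)]
      exact le_ciSup hb y

/-- The log-Sobolev inequality with constant `C`, tested on all smooth functions for which the
expectations that occur in it are finite. -/
def LogSobolev {E : Type*} [NormedAddCommGroup E] [NormedSpace ℝ E] [MeasurableSpace E]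
    (μ : Measure E) (C : ℝ) : Prop :=
  ∀ f : E → ℝ, ContDiff ℝ (⊤ : ℕ∞) f →
    Integrable (fun x => f x ^ 2) μ →
    Integrable (fun x => f x ^ 2 * Real.log (f x ^ 2)) μ →
    Integrable (fun x => gradNorm f x ^ 2) μ →
    (∫ x, f x ^ 2 * Real.log (f x ^ 2) ∂μ)
        - (∫ x, f x ^ 2 ∂μ) * Real.log (∫ x, f x ^ 2 ∂μ)
      ≤ 2 * C * ∫ x, gradNorm f x ^ 2 ∂μ

end EmpiricalWasserstein

end

/-! As a function of the sample `x` in `E ^ n`, the distance from the empirical measure to `μ` is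
Lipschitz for the `ℓ²` norm with constant `L = n ^ (-1 / max 2 p)`: moving the sample points while
keeping the part of `μ` assigned to each costs at most their `ℓ^p` mean displacement
(`wasserstein_empiricalMeasure_le_add`, `rpow_mean_le_mul_l2`). It then suffices that `L`-Lipschitz
functions of the sample are sub-Gaussian with variance proxy `C * L ^ 2`
(`LogSobolev.hasSubgaussianMGF`), and Chernoff's bound concludes.

For smooth bounded functions this is the classical route: entropy is subadditive on products, so the
log-Sobolev inequality tensorizes (`LogSobolev.expEntropy_pi_le`), and Herbst's argument turns the
entropy bound into a Laplace transform bound.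

The distance is not smooth, and a Banach space need not carry a smooth norm. Lipschitz functions are
therefore approximated by lattice polynomials in affine functions, exact along a sequence whose
closure has full measure, with maxima smoothed by log-sum-exp (`exists_seq_smoothLip_tendsto`).
Since `E` may be nonseparable, continuous functions on `E ^ n` need not be measurable for the
product `σ`-algebra, so measurability is carried along explicitly. -/

namespace EmpiricalWasserstein

/-! ### Entropy: variational bound and subadditivity. -/

section Entropy

variable {α β : Type*} [MeasurableSpace α] [MeasurableSpace β]

lemma integrable_of_measurable_bounded {μ : Measure α} [IsFiniteMeasure μ] {f : α → ℝ} {B : ℝ}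
    (hf : Measurable f) (hB : ∀ x, |f x| ≤ B) : Integrable f μ :=
  Integrable.of_bound hf.aestronglyMeasurable B (ae_of_all _ hB)

lemma integrable_mul_exp {μ : Measure α} [IsFiniteMeasure μ] {f g : α → ℝ} {A B : ℝ}
    (hf : Measurable f) (hA : ∀ x, |f x| ≤ A) (hg : Measurable g) (hB : ∀ x, |g x| ≤ B) :
    Integrable (fun x => f x * Real.exp (g x)) μ := by
  refine integrable_of_measurable_bounded (B := A * Real.exp B) (by fun_prop) fun x => ?_
  rw [abs_mul, Real.abs_exp]
  exact mul_le_mul (hA x) (Real.exp_le_exp.2 ((le_abs_self _).trans (hB x)))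
    (Real.exp_pos _).le ((abs_nonneg _).trans (hA x))

lemma integrable_exp_of_bounded {μ : Measure α} [IsFiniteMeasure μ] {g : α → ℝ} {B : ℝ}
    (hg : Measurable g) (hB : ∀ x, |g x| ≤ B) : Integrable (fun x => Real.exp (g x)) μ := by
  simpa using integrable_mul_exp (μ := μ) (f := fun _ => 1) (A := 1) measurable_const
    (by simp) hg hB

lemma integral_exp_mem_Icc {μ : Measure α} [IsProbabilityMeasure μ] {g : α → ℝ} {B : ℝ}
    (hg : Measurable g) (hB : ∀ x, |g x| ≤ B) :
    ∫ x, Real.exp (g x) ∂μ ∈ Set.Icc (Real.exp (-B)) (Real.exp B) := by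
  have hi := integrable_exp_of_bounded (μ := μ) hg hB
  constructor
  · calc Real.exp (-B) = ∫ _, Real.exp (-B) ∂μ := by simp
      _ ≤ _ := integral_mono (integrable_const _) hi
        (fun x => Real.exp_le_exp.2 (abs_le.1 (hB x)).1)
  · refine (integral_mono hi (integrable_const (Real.exp B))
      fun x => Real.exp_le_exp.2 (abs_le.1 (hB x)).2).trans ?_
    simp

lemma integral_exp_pos_of_bounded {μ : Measure α} [IsProbabilityMeasure μ] {g : α → ℝ} {B : ℝ}
    (hg : Measurable g) (hB : ∀ x, |g x| ≤ B) : 0 < ∫ x, Real.exp (g x) ∂μ :=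
  (Real.exp_pos _).trans_le (integral_exp_mem_Icc hg hB).1

lemma abs_log_integral_exp_le {μ : Measure α} [IsProbabilityMeasure μ] {g : α → ℝ} {B : ℝ}
    (hg : Measurable g) (hB : ∀ x, |g x| ≤ B) : |Real.log (∫ x, Real.exp (g x) ∂μ)| ≤ B := by
  have h := integral_exp_mem_Icc (μ := μ) hg hB
  have hp := integral_exp_pos_of_bounded (μ := μ) hg hB
  exact abs_le.2 ⟨(Real.le_log_iff_exp_le hp).2 h.1, (Real.log_le_iff_le_exp hp).2 h.2⟩

/-- The entropy of `exp f` under `μ`. -/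
noncomputable def expEntropy (μ : Measure α) (f : α → ℝ) : ℝ :=
  ∫ x, f x * Real.exp (f x) ∂μ -
    (∫ x, Real.exp (f x) ∂μ) * Real.log (∫ x, Real.exp (f x) ∂μ)

/-- The variational lower bound for the entropy. -/
lemma integral_mul_exp_sub_le_expEntropy {μ : Measure α} [IsProbabilityMeasure μ]
    {f h : α → ℝ} {A B : ℝ} (hf : Measurable f) (hA : ∀ x, |f x| ≤ A)
    (hh : Measurable h) (hB : ∀ x, |h x| ≤ B) :
    ∫ x, (h x - Real.log (∫ y, Real.exp (h y) ∂μ)) * Real.exp (f x) ∂μ ≤ expEntropy μ f := by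
  set H := ∫ y, Real.exp (h y) ∂μ with hH
  set M := ∫ y, Real.exp (f y) ∂μ with hM
  have hH0 : 0 < H := integral_exp_pos_of_bounded hh hB
  have hM0 : 0 < M := integral_exp_pos_of_bounded hf hA
  have i1 := integrable_exp_of_bounded (μ := μ) hf hA
  have i2 := integrable_exp_of_bounded (μ := μ) hh hB
  have i3 := integrable_mul_exp (μ := μ) hf hA hf hA
  have i4 := integrable_mul_exp (μ := μ) hh hB hf hA
  -- This is `u + 1 ≤ exp u` at `u = (h - log H) - (f - log M)`, weighted by `exp f` and integrated.
  -- The right side vanishes because both terms have integral `M`.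
  have key : ∫ x, (h x * Real.exp (f x) - Real.log H * Real.exp (f x)
      - (f x * Real.exp (f x) - Real.log M * Real.exp (f x))) ∂μ
      ≤ ∫ x, (Real.exp (h x) * (M / H) - Real.exp (f x)) ∂μ := by
    refine integral_mono ((i4.sub (i1.const_mul _)).sub (i3.sub (i1.const_mul _)))
      ((i2.mul_const _).sub i1) fun x => ?_
    have e : Real.exp (h x) * (M / H)
        = Real.exp (f x) * Real.exp (h x - Real.log H - (f x - Real.log M)) := by
      rw [Real.exp_sub, Real.exp_sub, Real.exp_sub, Real.exp_log hH0, Real.exp_log hM0]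
      field_simp
    have := mul_le_mul_of_nonneg_left (Real.add_one_le_exp (h x - Real.log H - (f x - Real.log M)))
      (Real.exp_pos (f x)).le
    simp only [e]
    linarith
  have i5 : Integrable (fun x => h x * Real.exp (f x) - Real.log H * Real.exp (f x)) μ :=
    i4.sub (i1.const_mul _)
  have i6 : Integrable (fun x => f x * Real.exp (f x) - Real.log M * Real.exp (f x)) μ :=
    i3.sub (i1.const_mul _)
  rw [integral_sub i5 i6, integral_sub i4 (i1.const_mul _), integral_sub i3 (i1.const_mul _),
    integral_sub (i2.mul_const _) i1, integral_const_mul, integral_const_mul,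
    integral_mul_const, ← hH, ← hM, mul_div_cancel₀ _ hH0.ne', sub_self] at key
  simp_rw [sub_mul]
  rw [integral_sub i4 (i1.const_mul _), integral_const_mul, expEntropy, ← hM]
  linarith

/-- Subadditivity of the entropy on a product of two probability spaces, in integrated form. -/
lemma expEntropy_prod_le {μ : Measure α} {ν : Measure β} [IsProbabilityMeasure μ]
    [IsProbabilityMeasure ν] {F G₁ G₂ : α × β → ℝ} {B D : ℝ}
    (hF : Measurable F) (hB : ∀ z, |F z| ≤ B)
    (hG₁ : Measurable G₁) (hD₁ : ∀ z, |G₁ z| ≤ D) (hG₂ : Measurable G₂) (hD₂ : ∀ z, |G₂ z| ≤ D)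
    (h₁ : ∀ y, expEntropy μ (fun x => F (x, y)) ≤
      ∫ x, G₁ (x, y) * Real.exp (F (x, y)) ∂μ)
    (h₂ : ∀ x, expEntropy ν (fun y => F (x, y)) ≤
      ∫ y, G₂ (x, y) * Real.exp (F (x, y)) ∂ν) :
    expEntropy (μ.prod ν) F ≤ ∫ z, (G₁ z + G₂ z) * Real.exp (F z) ∂(μ.prod ν) := by
  have iE := integrable_exp_of_bounded (μ := μ.prod ν) hF hB
  have iF := integrable_mul_exp (μ := μ.prod ν) hF hB hF hB
  have i1 := integrable_mul_exp (μ := μ.prod ν) hG₁ hD₁ hF hB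
  have i2 := integrable_mul_exp (μ := μ.prod ν) hG₂ hD₂ hF hB
  have mx : ∀ x, Measurable fun y => F (x, y) := fun x => hF.comp measurable_prodMk_left
  have my : ∀ y, Measurable fun x => F (x, y) := fun y => hF.comp measurable_prodMk_right
  set h : α → ℝ := fun x => Real.log (∫ y, Real.exp (F (x, y)) ∂ν) with hh
  have hmeas : Measurable h :=
    ((hF.exp.stronglyMeasurable).integral_prod_right').measurable.log
  have hbd : ∀ x, |h x| ≤ B := fun x => abs_log_integral_exp_le (mx x) fun y => hB _
  have hexp : ∀ x, Real.exp (h x) = ∫ y, Real.exp (F (x, y)) ∂ν := fun x =>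
    Real.exp_log (integral_exp_pos_of_bounded (mx x) fun y => hB _)
  have hM : ∫ z, Real.exp (F z) ∂(μ.prod ν) = ∫ x, Real.exp (h x) ∂μ := by
    rw [integral_prod _ iE]; simp_rw [hexp]
  set M := ∫ x, Real.exp (h x) ∂μ with hMdef
  have hh1 : Measurable fun z : α × β => h z.1 := hmeas.comp measurable_fst
  have iH := integrable_mul_exp (μ := μ.prod ν) hh1 (fun z => hbd z.1) hF hB
  -- Chain rule: with `h` the logarithm of the partial integral over `y`, the entropy is the
  -- averaged conditional entropy plus the entropy of the marginal density `exp h`.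
  have split : expEntropy (μ.prod ν) F
      = ∫ z, (F z - h z.1) * Real.exp (F z) ∂(μ.prod ν)
        + ∫ z, (h z.1 - Real.log M) * Real.exp (F z) ∂(μ.prod ν) := by
    simp_rw [sub_mul]
    rw [integral_sub iF iH, integral_sub iH (iE.const_mul _), integral_const_mul, expEntropy, hM]
    ring
  have b1 : ∫ z, (F z - h z.1) * Real.exp (F z) ∂(μ.prod ν)
      ≤ ∫ z, G₂ z * Real.exp (F z) ∂(μ.prod ν) := by
    have i3 : Integrable (fun z => (F z - h z.1) * Real.exp (F z)) (μ.prod ν) := by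
      simp_rw [sub_mul]; exact iF.sub iH
    rw [integral_prod _ i3, integral_prod _ i2]
    refine integral_mono i3.integral_prod_left i2.integral_prod_left fun x => ?_
    refine le_trans (le_of_eq ?_) (h₂ x)
    simp_rw [sub_mul]
    rw [integral_sub (integrable_mul_exp (mx x) (fun y => hB _) (mx x) (fun y => hB _))
      ((integrable_exp_of_bounded (mx x) (fun y => hB _)).const_mul _), integral_const_mul,
      expEntropy]
    simp only [hh]
    ring
  -- For each fixed `y`, `h` is a test function in the variational bound for `F (·, y)`.
  have b2 : ∫ z, (h z.1 - Real.log M) * Real.exp (F z) ∂(μ.prod ν)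
      ≤ ∫ z, G₁ z * Real.exp (F z) ∂(μ.prod ν) := by
    have i3 : Integrable (fun z => (h z.1 - Real.log M) * Real.exp (F z)) (μ.prod ν) := by
      simp_rw [sub_mul]; exact iH.sub (iE.const_mul _)
    rw [integral_prod_symm _ i3, integral_prod_symm _ i1]
    exact integral_mono i3.integral_prod_right i1.integral_prod_right fun y =>
      (integral_mul_exp_sub_le_expEntropy (my y) (fun x => hB _) hmeas hbd).trans (h₁ y)
  rw [split]
  simp_rw [add_mul]
  rw [integral_add i1 i2]
  linarith

end Entropy

/-! ### Tensorization of the log-Sobolev inequality. -/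

section Tensorization

variable {E : Type*} [NormedAddCommGroup E] [NormedSpace ℝ E] [MeasurableSpace E] [BorelSpace E]

lemma LogSobolev.expEntropy_le {μ : Measure E} [IsProbabilityMeasure μ] {C : ℝ}
    (hC : 0 ≤ C) (hμ : LogSobolev μ C) {F Γ : E → ℝ} {B D : ℝ} (hF : ContDiff ℝ (⊤ : ℕ∞) F)
    (hB : ∀ x, |F x| ≤ B) (hΓ : Measurable Γ) (hD : ∀ x, |Γ x| ≤ D)
    (hFΓ : ∀ x, ‖fderiv ℝ F x‖ ^ 2 ≤ Γ x) :
    expEntropy μ F ≤ ∫ x, (C / 2 * Γ x) * Real.exp (F x) ∂μ := by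
  have hFm : Measurable F := hF.continuous.measurable
  -- Then `f ^ 2 = exp F` and the squared gradient is `‖F'‖ ^ 2 * exp F / 4`, which turns the
  -- constant `2 * C` into `C / 2`.
  set f : E → ℝ := fun x => Real.exp (F x / 2) with hf
  have hfs : ContDiff ℝ (⊤ : ℕ∞) f := (hF.div_const 2).exp
  have hf2 : ∀ x, f x ^ 2 = Real.exp (F x) := fun x => by
    rw [hf, ← Real.exp_nat_mul]; congr 1; push_cast; ring
  have hgrad : ∀ x, gradNorm f x ^ 2 = 1 / 4 * (‖fderiv ℝ F x‖ ^ 2 * Real.exp (F x)) := by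
    intro x
    have hd : DifferentiableAt ℝ F x := (hF.differentiable (by simp)) x
    have h1 : HasFDerivAt f (Real.exp (F x / 2) • ((2 : ℝ)⁻¹ • fderiv ℝ F x)) x := by
      have := (hd.hasFDerivAt.mul_const (2 : ℝ)⁻¹).exp
      simpa only [hf, div_eq_mul_inv] using this
    rw [gradNorm_eq_norm_fderiv h1.differentiableAt, h1.fderiv, norm_smul, norm_smul, mul_pow,
      mul_pow, Real.norm_eq_abs, sq_abs, ← hf2 x]
    norm_num
    ring
  have hcont : Continuous (fun x => ‖fderiv ℝ F x‖ ^ 2) :=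
    ((hF.continuous_fderiv (by simp)).norm.pow 2)
  have hD' : ∀ x, |‖fderiv ℝ F x‖ ^ 2| ≤ D := fun x => by
    rw [abs_of_nonneg (sq_nonneg _)]
    exact (hFΓ x).trans ((le_abs_self _).trans (hD x))
  have ig := integrable_mul_exp (μ := μ) hcont.measurable hD' hFm hB
  have key := hμ f hfs
    (by simpa only [hf2] using integrable_exp_of_bounded hFm hB)
    (by simpa only [hf2, Real.log_exp, mul_comm] using integrable_mul_exp hFm hB hFm hB)
    (by simpa only [hgrad] using ig.const_mul _)
  simp only [hf2, Real.log_exp, hgrad] at key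
  rw [integral_const_mul] at key
  have h2 : ∫ x, ‖fderiv ℝ F x‖ ^ 2 * Real.exp (F x) ∂μ ≤ ∫ x, Γ x * Real.exp (F x) ∂μ :=
    integral_mono ig (integrable_mul_exp hΓ hD hFm hB) fun x =>
      mul_le_mul_of_nonneg_right (hFΓ x) (Real.exp_pos _).le
  simp_rw [mul_assoc]
  rw [integral_const_mul, expEntropy]
  simp_rw [mul_comm (F _) (Real.exp _)]
  have := mul_le_mul_of_nonneg_left h2 (by positivity : 0 ≤ C / 2)
  linarith

/-- Induction on `n`, splitting off coordinate `0` and using subadditivity. `Γ` dominates the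
squared partial derivatives, with measurability for the product `σ`-algebra as a hypothesis. -/
lemma LogSobolev.expEntropy_pi_le {μ : Measure E} [IsProbabilityMeasure μ] {C : ℝ}
    (hC : 0 ≤ C) (hμ : LogSobolev μ C) {B D : ℝ} {n : ℕ} {F : (Fin n → E) → ℝ}
    {Γ : Fin n → (Fin n → E) → ℝ} (hF : Measurable F) (hB : ∀ x, |F x| ≤ B)
    (hFs : ∀ x i, ContDiff ℝ (⊤ : ℕ∞) fun z => F (Function.update x i z))
    (hΓ : ∀ i, Measurable (Γ i)) (hD : ∀ i x, |Γ i x| ≤ D)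
    (hFΓ : ∀ x i, ‖fderiv ℝ (fun z => F (Function.update x i z)) (x i)‖ ^ 2 ≤ Γ i x) :
    expEntropy (Measure.pi fun _ : Fin n => μ) F ≤
      ∫ x, (C / 2 * ∑ i, Γ i x) * Real.exp (F x) ∂(Measure.pi fun _ : Fin n => μ) := by
  induction n with
  | zero =>
    rw [expEntropy, Measure.pi_of_empty]
    simp [mul_comm]
  | succ n ih =>
    set e := (MeasurableEquiv.piFinSuccAbove (fun _ : Fin (n + 1) => E) 0).symm with he
    have hmp : MeasurePreserving e (μ.prod (Measure.pi fun _ : Fin n => μ))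
        (Measure.pi fun _ : Fin (n + 1) => μ) :=
      (measurePreserving_piFinSuccAbove (fun _ : Fin (n + 1) => μ) 0).symm
    have hecons : ∀ z : E × (Fin n → E), e z = Fin.cons z.1 z.2 := by
      intro z
      simp [he, MeasurableEquiv.piFinSuccAbove_symm_apply, Fin.insertNthEquiv]
    have hcons : Measurable fun z : E × (Fin n → E) => (Fin.cons z.1 z.2 : Fin (n + 1) → E) := by
      have := e.measurable
      rwa [show (⇑e) = fun z : E × (Fin n → E) => (Fin.cons z.1 z.2 : Fin (n + 1) → E) from
        funext hecons] at this
    have hint : ∀ g : (Fin (n + 1) → E) → ℝ, ∫ x, g x ∂(Measure.pi fun _ : Fin (n + 1) => μ)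
        = ∫ z, g (Fin.cons z.1 z.2) ∂(μ.prod (Measure.pi fun _ : Fin n => μ)) := by
      intro g
      rw [← hmp.integral_comp']
      simp only [hecons]
    have hD' : ∀ i x, |C / 2 * Γ i x| ≤ C / 2 * D := fun i x => by
      rw [abs_mul, abs_of_nonneg (by positivity)]
      exact mul_le_mul_of_nonneg_left (hD i x) (by positivity)
    have hsum : ∀ (s : Finset (Fin n)) (z : E × (Fin n → E)),
        |C / 2 * ∑ i ∈ s, Γ i.succ (Fin.cons z.1 z.2)| ≤ n * (C / 2 * D) := by
      intro s z
      rw [Finset.mul_sum]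
      refine (Finset.abs_sum_le_sum_abs _ _).trans ?_
      refine (Finset.sum_le_sum_of_subset_of_nonneg (Finset.subset_univ s)
        fun _ _ _ => abs_nonneg _).trans ?_
      refine (Finset.sum_le_sum fun i _ => hD' i.succ (Fin.cons z.1 z.2)).trans ?_
      simp
    have key := expEntropy_prod_le (μ := μ) (ν := Measure.pi fun _ : Fin n => μ)
      (F := fun z => F (Fin.cons z.1 z.2)) (B := B) (D := max (C / 2 * D) (n * (C / 2 * D)))
      (G₁ := fun z => C / 2 * Γ 0 (Fin.cons z.1 z.2))
      (G₂ := fun z => C / 2 * ∑ i : Fin n, Γ i.succ (Fin.cons z.1 z.2))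
      (hF.comp hcons) (fun z => hB _)
      (((hΓ 0).comp hcons).const_mul _) (fun z => (hD' _ _).trans (le_max_left _ _))
      ((Finset.measurable_fun_sum _ fun i _ => (hΓ i.succ).comp hcons).const_mul _)
      (fun z => (hsum _ z).trans (le_max_right _ _))
      (fun y => by
        have hs : ∀ x, (fun z => F (Function.update (Fin.cons x y : Fin (n + 1) → E) 0 z))
            = fun z => F (Fin.cons z y) := fun x => by
          simp only [Fin.update_cons_zero]
        refine hμ.expEntropy_le hC (B := B) (D := D) (Γ := fun x => Γ 0 (Fin.cons x y)) ?_
          (fun x => hB _) (((hΓ 0).comp hcons).comp measurable_prodMk_right)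
          (fun x => hD _ _) fun x => ?_
        · rw [← hs 0]; exact hFs _ _
        · have := hFΓ (Fin.cons x y) 0
          rwa [hs x, Fin.cons_zero] at this)
      (fun x => by
        have hs : ∀ y i, (fun z => F (Function.update (Fin.cons x y : Fin (n + 1) → E)
            (Fin.succ i) z)) = fun z => F (Fin.cons x (Function.update y i z)) := fun y i => by
          simp only [Fin.cons_update]
        refine ih (F := fun y => F (Fin.cons x y)) (Γ := fun i y => Γ i.succ (Fin.cons x y))
          ((hF.comp hcons).comp measurable_prodMk_left) (fun y => hB _) (fun y i => ?_)
          (fun i => ((hΓ i.succ).comp hcons).comp measurable_prodMk_left) (fun i y => hD _ _)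
          fun y i => ?_
        · rw [← hs y i]; exact hFs _ _
        · have := hFΓ (Fin.cons x y) i.succ
          rwa [hs y i, Fin.cons_succ] at this)
    have hent : expEntropy (Measure.pi fun _ : Fin (n + 1) => μ) F
        = expEntropy (μ.prod (Measure.pi fun _ : Fin n => μ)) fun z => F (Fin.cons z.1 z.2) := by
      simp only [expEntropy, hint]
    rw [hent, hint]
    refine key.trans (le_of_eq ?_)
    simp only [Fin.sum_univ_succ, mul_add]

end Tensorization

/-- Herbst's argument. -/
lemma integral_exp_le_of_expEntropy_le {α : Type*} [MeasurableSpace α] {μ : Measure α}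
    [IsProbabilityMeasure μ] {f : α → ℝ} {B c : ℝ} (hf : Measurable f) (hB : ∀ x, |f x| ≤ B)
    (h : ∀ t : ℝ, 0 < t →
      expEntropy μ (fun x => t * f x) ≤ c * t ^ 2 * ∫ x, Real.exp (t * f x) ∂μ) :
    ∫ x, Real.exp (f x) ∂μ ≤ Real.exp (∫ x, f x ∂μ + c) := by
  have hbd : ∀ t x, |t * f x| ≤ |t| * B := fun t x => by
    rw [abs_mul]; exact mul_le_mul_of_nonneg_left (hB x) (abs_nonneg _)
  have hset : integrableExpSet f μ = Set.univ := by
    ext t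
    simpa [integrableExpSet] using integrable_exp_of_bounded (hf.const_mul t) (hbd t)
  have hder : ∀ t, HasDerivAt (mgf f μ) (∫ x, f x * Real.exp (t * f x) ∂μ) t := fun t =>
    hasDerivAt_mgf (by simp [hset])
  have hpos : ∀ t, 0 < mgf f μ t := fun t =>
    integral_exp_pos_of_bounded (hf.const_mul t) (hbd t)
  have hlog : ∀ t, HasDerivAt (fun t => Real.log (mgf f μ t))
      ((∫ x, f x * Real.exp (t * f x) ∂μ) / mgf f μ t) t := fun t => (hder t).log (hpos t).ne'
  have hu : ∀ t, t ≠ 0 → HasDerivAt (fun t => Real.log (mgf f μ t) / t - c * t)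
      (((∫ x, f x * Real.exp (t * f x) ∂μ) / mgf f μ t * t - Real.log (mgf f μ t) * 1) / t ^ 2
        - c * 1) t := fun t ht =>
    ((hlog t).div (hasDerivAt_id' t) ht).sub ((hasDerivAt_id' t).const_mul c)
  -- The derivative of `log (mgf f μ t) / t` is the entropy of `exp (t * f)` divided by `t ^ 2 * mgf
  -- f μ t`, hence at most `c`.
  have hanti : AntitoneOn (fun t => Real.log (mgf f μ t) / t - c * t) (Set.Ioi 0) := by
    refine antitoneOn_of_deriv_nonpos (convex_Ioi 0)
      (fun t ht => (hu t (ne_of_gt ht)).continuousAt.continuousWithinAt)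
      (fun t ht => (hu t (ne_of_gt (interior_subset ht))).differentiableAt.differentiableWithinAt)
      fun t ht => ?_
    have ht : 0 < t := interior_subset ht
    rw [(hu t ht.ne').deriv]
    have h1 := h t ht
    have h2 : ∫ x, t * f x * Real.exp (t * f x) ∂μ = t * ∫ x, f x * Real.exp (t * f x) ∂μ := by
      simp_rw [mul_assoc]; rw [integral_const_mul]
    rw [expEntropy, h2] at h1
    change t * _ - mgf f μ t * Real.log (mgf f μ t) ≤ c * t ^ 2 * mgf f μ t at h1
    have hp := hpos t
    have ht2 : 0 < t ^ 2 := by positivity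
    rw [sub_nonpos, mul_one, mul_one, div_le_iff₀ ht2, ← mul_le_mul_iff_left₀ hp]
    have : ((∫ x, f x * Real.exp (t * f x) ∂μ) / mgf f μ t * t - Real.log (mgf f μ t)) * mgf f μ t
      = t * (∫ x, f x * Real.exp (t * f x) ∂μ) - mgf f μ t * Real.log (mgf f μ t) := by
      rw [sub_mul, mul_assoc, mul_comm t, ← mul_assoc, div_mul_cancel₀ _ hp.ne']
      ring
    linarith
  -- The log-Laplace transform vanishes at `0`, so the quotient is its slope there and tends to the
  -- mean.
  have hlim : Tendsto (fun t => Real.log (mgf f μ t) / t - c * t) (𝓝[>] 0)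
      (𝓝 (∫ x, f x ∂μ)) := by
    have h1 := (hlog 0).tendsto_slope_zero_right
    have h2 : Tendsto (fun t : ℝ => c * t) (𝓝[>] 0) (𝓝 (c * 0)) :=
      ((continuous_const.mul continuous_id).tendsto 0).mono_left nhdsWithin_le_nhds
    have h3 := h1.sub h2
    simp only [mgf_zero, zero_add, Real.log_one, sub_zero, smul_eq_mul, zero_mul, Real.exp_zero,
      mul_one, div_one, mul_zero] at h3
    refine h3.congr fun t => ?_
    rw [div_eq_inv_mul]
  have h1 : Real.log (mgf f μ 1) / 1 - c * 1 ≤ ∫ x, f x ∂μ := by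
    refine ge_of_tendsto hlim ?_
    filter_upwards [Ioc_mem_nhdsGT (zero_lt_one (α := ℝ))] with t ht
    exact hanti ht.1 (Set.mem_Ioi.2 zero_lt_one) ht.2
  have h2 : Real.log (mgf f μ 1) ≤ ∫ x, f x ∂μ + c := by linarith
  have h3 := (Real.log_le_iff_le_exp (hpos 1)).1 h2
  simpa [mgf] using h3

/-! ### Smooth Lipschitz functions on the product space. -/

section SmoothLip

variable {E : Type*} [NormedAddCommGroup E] [NormedSpace ℝ E] {n : ℕ}

/-- Duality: the dual of an `ℓ²` sum is the `ℓ²` sum of the duals. Testing on vectors with blocks `a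
i • v i`, where `v i` nearly norms the `i`-th component, gives `s ^ 2 ≤ |L| * s`; the `ε` is there
because the dual norm need not be attained. -/
lemma sum_norm_comp_single_sq_le {ℓ : (Fin n → E) →L[ℝ] ℝ} {L : ℝ}
    (h : ∀ v, ℓ v ≤ L * ‖WithLp.toLp 2 v‖) :
    ∑ i, ‖ℓ.comp (ContinuousLinearMap.single ℝ (fun _ => E) i)‖ ^ 2 ≤ L ^ 2 := by
  set a : Fin n → ℝ := fun i => ‖ℓ.comp (ContinuousLinearMap.single ℝ (fun _ => E) i)‖ with ha
  set s : ℝ := √(∑ i, a i ^ 2) with hs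
  have hs0 : 0 ≤ s := Real.sqrt_nonneg _
  have hs2 : s ^ 2 = ∑ i, a i ^ 2 := Real.sq_sqrt (by positivity)
  suffices H : s ^ 2 ≤ |L| * s by
    rw [← hs2, ← sq_abs L]
    rcases hs0.eq_or_lt with h0 | h0
    · rw [← h0, zero_pow two_ne_zero]; positivity
    · have : s ≤ |L| := by nlinarith
      gcongr
  have key : ∀ ε : ℝ, 0 < ε → s ^ 2 - ε * ∑ i, a i ≤ |L| * s := by
    intro ε hε
    have hv : ∀ i, ∃ v : E, ‖v‖ ≤ 1 ∧
        a i - ε ≤ ℓ (ContinuousLinearMap.single ℝ (fun _ => E) i v) := by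
      intro i
      by_contra! hcon
      have hnn : 0 ≤ a i - ε := by
        have := hcon 0 (by simp)
        simp only [map_zero] at this
        exact this.le
      have : a i ≤ a i - ε := by
        refine ContinuousLinearMap.opNorm_le_of_unit_norm hnn fun v hv => ?_
        rw [Real.norm_eq_abs, abs_le]
        constructor
        · have := hcon (-v) (by rw [norm_neg, hv])
          rw [map_neg, map_neg] at this
          simp only [ContinuousLinearMap.comp_apply]
          linarith
        · exact (hcon v hv.le).le
      linarith
    choose v hv1 hv2 using hv
    set w : Fin n → E := fun i => a i • v i with hw
    have hsum : ℓ w = ∑ i, a i * ℓ (ContinuousLinearMap.single ℝ (fun _ => E) i (v i)) := by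
      have : w = ∑ i, a i • ContinuousLinearMap.single ℝ (fun _ => E) i (v i) := by
        ext j
        simp [hw, Finset.sum_apply, Pi.single_apply]
      rw [this, map_sum]
      simp
    have hnorm : ‖WithLp.toLp 2 w‖ ≤ s := by
      rw [PiLp.norm_eq_of_L2, hs]
      refine Real.sqrt_le_sqrt (Finset.sum_le_sum fun i _ => ?_)
      simp only [hw, norm_smul, Real.norm_eq_abs, mul_pow, sq_abs]
      nlinarith [hv1 i, norm_nonneg (v i), sq_nonneg (a i),
        mul_le_mul_of_nonneg_left (pow_le_one₀ (n := 2) (norm_nonneg (v i)) (hv1 i))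
          (sq_nonneg (a i))]
    have h1 : ∑ i, a i * (a i - ε) ≤ ℓ w := by
      rw [hsum]
      exact Finset.sum_le_sum fun i _ => mul_le_mul_of_nonneg_left (hv2 i) (norm_nonneg _)
    have h2 : s ^ 2 - ε * ∑ i, a i = ∑ i, a i * (a i - ε) := by
      rw [hs2, Finset.mul_sum, ← Finset.sum_sub_distrib]
      exact Finset.sum_congr rfl fun i _ => by ring
    calc s ^ 2 - ε * ∑ i, a i ≤ ℓ w := h2 ▸ h1
      _ ≤ L * ‖WithLp.toLp 2 w‖ := h w
      _ ≤ |L| * ‖WithLp.toLp 2 w‖ := by gcongr; exact le_abs_self L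
      _ ≤ |L| * s := by gcongr
  have hlim : Tendsto (fun ε : ℝ => s ^ 2 - ε * ∑ i, a i) (𝓝[>] 0)
      (𝓝 (s ^ 2 - 0 * ∑ i, a i)) :=
    (Continuous.tendsto (by fun_prop) 0).mono_left nhdsWithin_le_nhds
  rw [zero_mul, sub_zero] at hlim
  exact le_of_tendsto hlim (eventually_mem_nhdsWithin.mono fun ε hε => key ε hε)

variable [MeasurableSpace E]

/-- Smooth functions on `E ^ n` that are `L`-Lipschitz for the `ℓ²` norm, and measurable together
with their derivative for the product `σ`-algebra. -/
structure SmoothLip (L : ℝ) (F : (Fin n → E) → ℝ) : Prop where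
  contDiff : ContDiff ℝ (⊤ : ℕ∞) F
  measurable : Measurable F
  stronglyMeasurable_fderiv : StronglyMeasurable (fderiv ℝ F)
  lip : ∀ x v, F (x + v) ≤ F x + L * ‖WithLp.toLp 2 v‖

namespace SmoothLip

variable {L : ℝ} {F : (Fin n → E) → ℝ}

lemma differentiable (hF : SmoothLip L F) : Differentiable ℝ F :=
  hF.contDiff.differentiable (by simp)

lemma fderiv_le (hF : SmoothLip L F) (x v : Fin n → E) :
    fderiv ℝ F x v ≤ L * ‖WithLp.toLp 2 v‖ := by
  have h1 : HasDerivAt (fun t : ℝ => F (x + t • v)) (fderiv ℝ F x v) 0 :=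
    (hF.differentiable x).hasFDerivAt.hasLineDerivAt v
  refine le_of_tendsto h1.tendsto_slope_zero_right ?_
  filter_upwards [self_mem_nhdsWithin] with t ht
  have ht : (0 : ℝ) < t := ht
  have := hF.lip x (t • v)
  rw [WithLp.toLp_smul, norm_smul, Real.norm_eq_abs, abs_of_pos ht] at this
  rw [smul_eq_mul, inv_mul_le_iff₀ ht]
  simp only [zero_add, zero_smul, add_zero]
  linarith

lemma const_mul (hF : SmoothLip L F) {t : ℝ} (ht : 0 ≤ t) :
    SmoothLip (t * L) fun x => t * F x where
  contDiff := contDiff_const.mul hF.contDiff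
  measurable := hF.measurable.const_mul t
  stronglyMeasurable_fderiv := by
    have : fderiv ℝ (fun x => t * F x) = fun x => t • fderiv ℝ F x :=
      funext fun x => fderiv_const_mul (hF.differentiable x) t
    rw [this]
    exact hF.stronglyMeasurable_fderiv.const_smul t
  lip x v := by
    have := mul_le_mul_of_nonneg_left (hF.lip x v) ht
    linarith

lemma neg (hF : SmoothLip L F) : SmoothLip L fun x => -F x where
  contDiff := hF.contDiff.neg
  measurable := hF.measurable.neg
  stronglyMeasurable_fderiv := by
    have : fderiv ℝ (fun x => -F x) = fun x => -fderiv ℝ F x := funext fun x => fderiv_fun_neg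
    rw [this]
    exact hF.stronglyMeasurable_fderiv.neg
  lip x v := by
    have := hF.lip (x + v) (-v)
    rw [WithLp.toLp_neg, norm_neg, add_neg_cancel_right] at this
    linarith

variable [BorelSpace E]

lemma expEntropy_le (hF : SmoothLip L F) {B : ℝ} (hB : ∀ x, |F x| ≤ B) {μ : Measure E}
    [IsProbabilityMeasure μ] {C : ℝ} (hC : 0 ≤ C) (hμ : LogSobolev μ C) :
    expEntropy (Measure.pi fun _ : Fin n => μ) F ≤
      C / 2 * L ^ 2 * ∫ x, Real.exp (F x) ∂(Measure.pi fun _ : Fin n => μ) := by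
  set Γ : Fin n → (Fin n → E) → ℝ := fun i x =>
    ‖(fderiv ℝ F x).comp (ContinuousLinearMap.single ℝ (fun _ => E) i)‖ ^ 2 with hΓ
  have hsum : ∀ x, ∑ i, Γ i x ≤ L ^ 2 := fun x => sum_norm_comp_single_sq_le (hF.fderiv_le x)
  have hΓ0 : ∀ i x, 0 ≤ Γ i x := fun i x => sq_nonneg _
  have hΓm : ∀ i, Measurable (Γ i) := fun i => by
    -- Strong measurability of the derivative passes through continuous maps, so no `σ`-algebra on
    -- the dual space enters.
    have hc : Continuous fun ℓ : (Fin n → E) →L[ℝ] ℝ =>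
        ‖ℓ.comp (ContinuousLinearMap.single ℝ (fun _ => E) i)‖ ^ 2 := by fun_prop
    exact (hc.comp_stronglyMeasurable hF.stronglyMeasurable_fderiv).measurable
  have hΓb : ∀ i x, |Γ i x| ≤ L ^ 2 := fun i x => by
    rw [abs_of_nonneg (hΓ0 i x)]
    exact (Finset.single_le_sum (fun j _ => hΓ0 j x) (Finset.mem_univ i)).trans (hsum x)
  have key := hμ.expEntropy_pi_le hC hF.measurable hB
    (fun x i => hF.contDiff.comp (contDiff_update _ x i)) hΓm hΓb
    (fun x i => by
      have h1 : HasFDerivAt F (fderiv ℝ F x) (Function.update x i (x i)) := by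
        rw [Function.update_eq_self]; exact (hF.differentiable x).hasFDerivAt
      have h2 := h1.comp (x i) (hasFDerivAt_update x (x i))
      have h3 := h2.fderiv
      refine le_of_eq ?_
      change ‖fderiv ℝ (F ∘ Function.update x i) (x i)‖ ^ 2 = _
      rw [h3, hΓ]
      congr 3
      ext v j
      by_cases hj : j = i
      · subst hj; simp
      · simp [hj])
  refine key.trans ?_
  rw [← integral_const_mul]
  refine integral_mono (integrable_mul_exp (A := C / 2 * L ^ 2)
    ((Finset.measurable_fun_sum _ fun i _ => hΓm i).const_mul _) (fun x => ?_) hF.measurable hB)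
    ((integrable_exp_of_bounded hF.measurable hB).const_mul _) fun x => ?_
  · rw [abs_of_nonneg (mul_nonneg (by positivity) (Finset.sum_nonneg fun i _ => hΓ0 i x))]
    exact mul_le_mul_of_nonneg_left (hsum x) (by positivity)
  · exact mul_le_mul_of_nonneg_right (mul_le_mul_of_nonneg_left (hsum x) (by positivity))
      (Real.exp_pos _).le

lemma integral_exp_le (hF : SmoothLip L F) {B : ℝ} (hB : ∀ x, |F x| ≤ B) {μ : Measure E}
    [IsProbabilityMeasure μ] {C : ℝ} (hC : 0 ≤ C) (hμ : LogSobolev μ C) :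
    ∫ x, Real.exp (F x) ∂(Measure.pi fun _ : Fin n => μ) ≤
      Real.exp (∫ x, F x ∂(Measure.pi fun _ : Fin n => μ) + C / 2 * L ^ 2) := by
  refine integral_exp_le_of_expEntropy_le hF.measurable hB fun t ht => ?_
  refine ((hF.const_mul ht.le).expEntropy_le (B := t * B) (fun x => ?_) hC hμ).trans
    (le_of_eq (by ring))
  rw [abs_mul, abs_of_pos ht]
  exact mul_le_mul_of_nonneg_left (hB x) ht.le

end SmoothLip

end SmoothLip

/-! ### Approximation of Lipschitz functions by smooth ones. -/

section Approximation

variable {E : Type*} [NormedAddCommGroup E] [NormedSpace ℝ E] {n : ℕ}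

/-- Hahn–Banach for the `ℓ²` norm, transported to the equivalent sup norm of the function space. -/
lemma exists_norming_functional (v : Fin n → E) : ∃ ℓ : (Fin n → E) →L[ℝ] ℝ,
    (∀ w, ℓ w ≤ ‖WithLp.toLp 2 w‖) ∧ ℓ v = ‖WithLp.toLp 2 v‖ := by
  obtain ⟨g, hg1, hg2⟩ := exists_dual_vector'' ℝ (WithLp.toLp 2 v : PiLp 2 fun _ : Fin n => E)
  refine ⟨g.comp (PiLp.continuousLinearEquiv 2 ℝ (fun _ : Fin n => E)).symm.toContinuousLinearMap,
    fun w => ?_, hg2⟩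
  calc g (WithLp.toLp 2 w) ≤ ‖g (WithLp.toLp 2 w)‖ := le_abs_self _
    _ ≤ 1 * ‖WithLp.toLp 2 w‖ := g.le_of_opNorm_le hg1 _
    _ = _ := one_mul _

variable [MeasurableSpace E]

namespace SmoothLip

variable {L : ℝ} {F G : (Fin n → E) → ℝ}

/-- The Lipschitz constant does not grow: both exponentials increase by a factor at most `exp (L *
‖v‖)`, and hence so does their sum. -/
lemma logSumExp (hF : SmoothLip L F) (hG : SmoothLip L G) :
    SmoothLip L fun x => Real.log (Real.exp (F x) + Real.exp (G x)) where
  contDiff := (hF.contDiff.exp.add hG.contDiff.exp).log fun x => by positivity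
  measurable := by
    have := hF.measurable
    have := hG.measurable
    fun_prop
  stronglyMeasurable_fderiv := by
    have hd : fderiv ℝ (fun x => Real.log (Real.exp (F x) + Real.exp (G x))) =
        fun x => (Real.exp (F x) + Real.exp (G x))⁻¹ •
          (Real.exp (F x) • fderiv ℝ F x + Real.exp (G x) • fderiv ℝ G x) := by
      funext x
      exact (((hF.differentiable x).hasFDerivAt.exp.add
        (hG.differentiable x).hasFDerivAt.exp).log
        (add_pos (Real.exp_pos _) (Real.exp_pos _)).ne').fderiv
    rw [hd]
    have h1 := hF.measurable.exp
    have h2 := hG.measurable.exp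
    exact (h1.add h2).inv.stronglyMeasurable.smul
      ((h1.stronglyMeasurable.smul hF.stronglyMeasurable_fderiv).add
        (h2.stronglyMeasurable.smul hG.stronglyMeasurable_fderiv))
  lip x v := by
    rw [Real.log_le_iff_le_exp (by positivity), Real.exp_add, Real.exp_log (by positivity), add_mul,
      ← Real.exp_add, ← Real.exp_add]
    exact add_le_add (Real.exp_le_exp.2 (hF.lip x v)) (Real.exp_le_exp.2 (hG.lip x v))

lemma affine [BorelSpace E] (hL : 0 ≤ L) {ℓ : (Fin n → E) →L[ℝ] ℝ}
    (hℓ : ∀ v, ℓ v ≤ ‖WithLp.toLp 2 v‖) (c : ℝ) : SmoothLip L fun x => c + L * ℓ x where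
  contDiff := contDiff_const.add (contDiff_const.mul ℓ.contDiff)
  measurable := by
    -- A sum of functions of single coordinates is measurable for the product `σ`-algebra.
    have h : ∀ x, ℓ x = ∑ i, ℓ.comp (ContinuousLinearMap.single ℝ (fun _ => E) i) (x i) := by
      intro x
      conv_lhs => rw [← Finset.univ_sum_single x]
      simp
    simp_rw [h]
    exact ((Finset.measurable_fun_sum _ fun i _ =>
      (ContinuousLinearMap.continuous _).measurable.comp (measurable_pi_apply i)).const_mul
        _).const_add _
  stronglyMeasurable_fderiv := by
    have : fderiv ℝ (fun x => c + L * ℓ x) = fun _ => L • ℓ :=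
      funext fun x => ((ℓ.hasFDerivAt.const_mul L).const_add c).fderiv
    rw [this]
    exact stronglyMeasurable_const
  lip x v := by
    rw [map_add]
    have := mul_le_mul_of_nonneg_left (hℓ v) hL
    linarith

end SmoothLip

/-- Functions that can be approximated uniformly by smooth `L`-Lipschitz functions. -/
def UnifApprox (L : ℝ) (H : (Fin n → E) → ℝ) : Prop :=
  ∀ ε : ℝ, 0 < ε → ∃ F, SmoothLip L F ∧ ∀ x, |F x - H x| ≤ ε

lemma SmoothLip.unifApprox {L : ℝ} {F : (Fin n → E) → ℝ} (hF : SmoothLip L F) :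
    UnifApprox L F := fun ε hε => ⟨F, hF, fun x => by simpa using hε.le⟩

namespace UnifApprox

variable {L : ℝ} {H K : (Fin n → E) → ℝ}

lemma sup (hH : UnifApprox L H) (hK : UnifApprox L K) : UnifApprox L (H ⊔ K) := by
  intro ε hε
  obtain ⟨F, hF, hFH⟩ := hH (ε / 2) (by positivity)
  obtain ⟨G, hG, hGK⟩ := hK (ε / 2) (by positivity)
  have hlog : 0 < Real.log 2 := Real.log_pos one_lt_two
  -- Log-sum-exp at inverse temperature `b` exceeds the maximum by at most `log 2 / b = ε / 2`.
  set b : ℝ := Real.log 2 / (ε / 2) with hb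
  have hb0 : 0 < b := by positivity
  refine ⟨fun x => b⁻¹ * Real.log (Real.exp (b * F x) + Real.exp (b * G x)), ?_, fun x => ?_⟩
  · have := ((hF.const_mul hb0.le).logSumExp (hG.const_mul hb0.le)).const_mul (inv_pos.2 hb0).le
    rwa [inv_mul_cancel_left₀ hb0.ne'] at this
  · have h1 : max (F x) (G x) ≤ b⁻¹ * Real.log (Real.exp (b * F x) + Real.exp (b * G x)) := by
      rw [le_inv_mul_iff₀ hb0, Real.le_log_iff_exp_le (by positivity)]
      rcases le_total (F x) (G x) with h | h
      · rw [max_eq_right h]; linarith [Real.exp_pos (b * F x)]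
      · rw [max_eq_left h]; linarith [Real.exp_pos (b * G x)]
    have h2 : b⁻¹ * Real.log (Real.exp (b * F x) + Real.exp (b * G x))
        ≤ max (F x) (G x) + ε / 2 := by
      have hbe : b * (ε / 2) = Real.log 2 := by rw [hb]; field_simp
      rw [inv_mul_le_iff₀ hb0, Real.log_le_iff_le_exp (by positivity), mul_add, hbe, Real.exp_add,
        Real.exp_log two_pos, mul_two]
      gcongr
      · exact le_max_left _ _
      · exact le_max_right _ _
    have h3 : |max (F x) (G x) - max (H x) (K x)| ≤ ε / 2 :=
      (abs_max_sub_max_le_max _ _ _ _).trans (max_le (hFH x) (hGK x))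
    rw [Pi.sup_apply, abs_le] at *
    constructor <;> linarith [h3.1, h3.2]

lemma neg (hH : UnifApprox L H) : UnifApprox L (-H) := fun ε hε => by
  obtain ⟨F, hF, hFH⟩ := hH ε hε
  refine ⟨_, hF.neg, fun x => ?_⟩
  rw [Pi.neg_apply, neg_sub_neg, abs_sub_comm]
  exact hFH x

lemma inf (hH : UnifApprox L H) (hK : UnifApprox L K) : UnifApprox L (H ⊓ K) := by
  have := (hH.neg.sup hK.neg).neg
  rwa [← neg_inf, neg_neg] at this

lemma lip (hH : UnifApprox L H) (x y : Fin n → E) :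
    |H x - H y| ≤ L * ‖WithLp.toLp 2 (x - y)‖ := by
  have key : ∀ x v, H (x + v) ≤ H x + L * ‖WithLp.toLp 2 v‖ := fun x v => by
    refine le_of_forall_pos_le_add fun ε hε => ?_
    obtain ⟨F, hF, hFH⟩ := hH (ε / 2) (by positivity)
    have h1 := abs_le.1 (hFH x)
    have h2 := abs_le.1 (hFH (x + v))
    linarith [hF.lip x v, h1.1, h1.2, h2.1, h2.2]
  have h1 := key y (x - y)
  have h2 := key x (y - x)
  rw [add_sub_cancel] at h1 h2
  rw [← neg_sub x y, WithLp.toLp_neg, norm_neg] at h2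
  rw [abs_le]
  constructor <;> linarith

end UnifApprox

variable [BorelSpace E]

/-- Interpolation of a bounded Lipschitz function along a sequence by lattice polynomials in
affine functions. -/
lemma exists_unifApprox_interpolation {L A : ℝ} (hL : 0 ≤ L) {G : (Fin n → E) → ℝ}
    (hG : ∀ x y, |G x - G y| ≤ L * ‖WithLp.toLp 2 (x - y)‖) (h0 : ∀ x, 0 ≤ G x)
    (hA : ∀ x, G x ≤ A) (y : ℕ → Fin n → E) (m : ℕ) :
    ∃ H, UnifApprox L H ∧ (∀ x, 0 ≤ H x ∧ H x ≤ A) ∧ ∀ r ≤ m, H (y r) = G (y r) := by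
  choose ℓ hℓ1 hℓ2 using fun j k : ℕ => exists_norming_functional (y k - y j)
  -- `T j k` equals `G` at `y j` and, by the Lipschitz bound, is at least `G` at `y k`. Hence the
  -- infimum over `j` of the suprema over `k` equals `G` at each `y r`: take `j = r` for the upper
  -- bound and `k = r` for the lower one.
  set T : ℕ → ℕ → (Fin n → E) → ℝ := fun j k x => G (y j) + L * ℓ j k (x - y j) with hT
  have hTa : ∀ j k, UnifApprox L (T j k) := fun j k => by
    have := (SmoothLip.affine hL (hℓ1 j k) (G (y j) - L * ℓ j k (y j))).unifApprox
    convert this using 2 with x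
    rw [hT]; simp only [map_sub]; ring
  have hne : (Finset.range (m + 1)).Nonempty := ⟨0, by simp⟩
  set S : ℕ → (Fin n → E) → ℝ := fun j => (Finset.range (m + 1)).sup' hne (T j) with hS
  have hSa : ∀ j, UnifApprox L (S j) := fun j =>
    Finset.sup'_induction hne (T j) (p := UnifApprox L) (fun _ h _ h' => h.sup h')
      fun k _ => hTa j k
  set R := (Finset.range (m + 1)).inf' hne S with hR
  have hRa : UnifApprox L R :=
    Finset.inf'_induction hne S (p := UnifApprox L) (fun _ h _ h' => h.inf h') fun j _ => hSa j
  have hconst : ∀ c : ℝ, UnifApprox L (fun _ : Fin n → E => c) := fun c => by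
    simpa using (SmoothLip.affine (E := E) (n := n) hL (ℓ := 0) (by simp) c).unifApprox
  -- Clipping to `[0, A]` provides the bound uniform in `m` that dominated convergence needs later.
  refine ⟨(R ⊓ fun _ => A) ⊔ fun _ => 0, (hRa.inf (hconst A)).sup (hconst 0), fun x => ?_,
    fun r hr => ?_⟩
  · simp only [Pi.sup_apply, Pi.inf_apply]
    exact ⟨le_sup_right, sup_le inf_le_right ((h0 0).trans (hA 0))⟩
  · have hr' : r ∈ Finset.range (m + 1) := Finset.mem_range.2 (by lia)
    have hle : R (y r) ≤ G (y r) := by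
      have h1 : R (y r) ≤ S r (y r) := Finset.inf'_le S hr' (y r)
      refine h1.trans ?_
      rw [hS]
      simp only [Finset.sup'_apply]
      refine Finset.sup'_le _ _ fun k _ => ?_
      simp [hT]
    have hge : G (y r) ≤ R (y r) := by
      rw [hR, Finset.inf'_apply]
      refine Finset.le_inf' _ _ fun j _ => ?_
      have h1 : T j r (y r) ≤ S j (y r) := Finset.le_sup' (T j) hr' (y r)
      refine le_trans ?_ h1
      have h2 := (le_abs_self _).trans (hG (y r) (y j))
      simp only [hT, hℓ2]
      linarith
    simp only [Pi.sup_apply, Pi.inf_apply, le_antisymm hle hge]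
    rw [inf_eq_left.2 (hA _), sup_eq_left.2 (h0 _)]

/-- `F m` is within `1 / (m + 1)` of a function interpolating `G` at `y 0, …, y m`; the common
Lipschitz constant carries convergence from the points of the sequence to its closure. -/
lemma exists_seq_smoothLip_tendsto {L A : ℝ} (hL : 0 ≤ L) {G : (Fin n → E) → ℝ}
    (hG : ∀ x y, |G x - G y| ≤ L * ‖WithLp.toLp 2 (x - y)‖) (h0 : ∀ x, 0 ≤ G x)
    (hA : ∀ x, G x ≤ A) (y : ℕ → Fin n → E) :
    ∃ F : ℕ → (Fin n → E) → ℝ, (∀ m, SmoothLip L (F m)) ∧ (∀ m x, |F m x| ≤ A + 1) ∧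
      ∀ x ∈ closure (Set.range y), Tendsto (fun m => F m x) atTop (𝓝 (G x)) := by
  choose H hHa hHb hHi using exists_unifApprox_interpolation hL hG h0 hA y
  have hpos : ∀ m : ℕ, (0 : ℝ) < 1 / ((m : ℝ) + 1) := fun m => by positivity
  have hle1 : ∀ m : ℕ, 1 / ((m : ℝ) + 1) ≤ 1 := fun m => by
    rw [div_le_one (by positivity)]; linarith [(Nat.cast_nonneg m : (0 : ℝ) ≤ m)]
  choose F hF hFH using fun m => hHa m _ (hpos m)
  refine ⟨F, hF, fun m x => ?_, fun x hx => ?_⟩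
  · have h1 := abs_le.1 (hFH m x)
    have h2 := hHb m x
    have h3 := hle1 m
    exact abs_le.2 ⟨by linarith [h0 x, hA x], by linarith⟩
  · have hcont : Continuous fun v : Fin n → E => 2 * (L * ‖WithLp.toLp 2 (x - v)‖) := by
      have := PiLp.continuous_toLp 2 (fun _ : Fin n => E)
      fun_prop
    rw [Metric.tendsto_atTop]
    intro ε hε
    have hopen : {v : Fin n → E | 2 * (L * ‖WithLp.toLp 2 (x - v)‖) < ε / 2} ∈ 𝓝 x :=
      (isOpen_lt hcont continuous_const).mem_nhds (by simpa using hε)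
    obtain ⟨_, hv, r, rfl⟩ := mem_closure_iff_nhds.1 hx _ hopen
    obtain ⟨N, hN⟩ := exists_nat_one_div_lt (half_pos hε)
    refine ⟨max r N, fun m hm => ?_⟩
    have e1 := abs_le.1 (hFH m x)
    have e2 := abs_le.1 ((hHa m).lip x (y r))
    have e3 := abs_le.1 (hG x (y r))
    have e4 := hHi m r ((le_max_left _ _).trans hm)
    have e5 : 1 / ((m : ℝ) + 1) < ε / 2 := by
      refine lt_of_le_of_lt ?_ hN
      have : (N : ℝ) ≤ m := by exact_mod_cast (le_max_right _ _).trans hm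
      gcongr
    have e6 : 2 * (L * ‖WithLp.toLp 2 (x - y r)‖) < ε / 2 := hv
    rw [Real.dist_eq, abs_lt]
    constructor <;> linarith [e1.1, e1.2, e2.1, e2.2, e3.1, e3.2]

end Approximation

/-! ### Sub-Gaussian concentration of Lipschitz functions. -/

section Concentration

/-- Fatou's lemma, in a form that also yields integrability of the limit. -/
lemma integrable_and_integral_le_of_tendsto {α : Type*} [MeasurableSpace α] {μ : Measure α}
    {f : ℕ → α → ℝ} {g : α → ℝ} {b : ℕ → ℝ} {c : ℝ} (hf0 : ∀ k x, 0 ≤ f k x)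
    (hf : ∀ k, Integrable (f k) μ) (hb : ∀ k, ∫ x, f k x ∂μ ≤ b k)
    (hbc : Tendsto b atTop (𝓝 c)) (hfg : ∀ᵐ x ∂μ, Tendsto (fun k => f k x) atTop (𝓝 (g x))) :
    Integrable g μ ∧ ∫ x, g x ∂μ ≤ c := by
  have hg0 : ∀ᵐ x ∂μ, 0 ≤ g x := by
    filter_upwards [hfg] with x hx using ge_of_tendsto' hx fun k => hf0 k x
  have hgm : AEStronglyMeasurable g μ :=
    aestronglyMeasurable_of_tendsto_ae _ (fun k => (hf k).aestronglyMeasurable) hfg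
  have hle : ∫⁻ x, ENNReal.ofReal (g x) ∂μ ≤ ENNReal.ofReal c := by
    have h1 : ∫⁻ x, ENNReal.ofReal (g x) ∂μ
        = ∫⁻ x, liminf (fun k => ENNReal.ofReal (f k x)) atTop ∂μ := by
      refine lintegral_congr_ae ?_
      filter_upwards [hfg] with x hx
      exact (((ENNReal.continuous_ofReal.tendsto _).comp hx).liminf_eq).symm
    have h2 : Tendsto (fun k => ENNReal.ofReal (b k)) atTop (𝓝 (ENNReal.ofReal c)) :=
      (ENNReal.continuous_ofReal.tendsto _).comp hbc
    rw [h1, ← h2.liminf_eq]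
    refine (lintegral_liminf_le' fun k => (hf k).aemeasurable.ennreal_ofReal).trans ?_
    refine liminf_le_liminf (Eventually.of_forall fun k => ?_)
    rw [← ofReal_integral_eq_lintegral_ofReal (hf k) (ae_of_all _ (hf0 k))]
    exact ENNReal.ofReal_le_ofReal (hb k)
  have hc : 0 ≤ c := ge_of_tendsto' hbc fun k => (integral_nonneg (hf0 k)).trans (hb k)
  refine ⟨⟨hgm, ?_⟩, ?_⟩
  · rw [hasFiniteIntegral_iff_ofReal hg0]
    exact hle.trans_lt ENNReal.ofReal_lt_top
  · rw [integral_eq_lintegral_of_nonneg_ae hg0 hgm]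
    exact ENNReal.toReal_le_of_le_ofReal hc hle

lemma exists_seq_ae_mem_closure {E : Type*} [NormedAddCommGroup E] [MeasurableSpace E]
    {μ : Measure E} [IsProbabilityMeasure μ]
    (hsep : ∃ S : Set E, TopologicalSpace.IsSeparable S ∧ ∀ᵐ x ∂μ, x ∈ S) (n : ℕ) :
    ∃ y : ℕ → Fin n → E,
      ∀ᵐ x ∂(Measure.pi fun _ : Fin n => μ), x ∈ closure (Set.range y) := by
  obtain ⟨S, ⟨c, hc, hSc⟩, hS⟩ := hsep
  obtain ⟨x₀, hx₀⟩ := hS.exists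
  have hcne : c.Nonempty := closure_nonempty_iff.1 ⟨x₀, hSc hx₀⟩
  have hcount : (Set.univ.pi fun _ : Fin n => c).Countable := Set.countable_univ_pi fun _ => hc
  obtain ⟨y, hy⟩ := hcount.exists_eq_range (Set.univ_pi_nonempty_iff.2 fun _ => hcne)
  refine ⟨y, ?_⟩
  have hall : ∀ᵐ x ∂(Measure.pi fun _ : Fin n => μ), ∀ i, x i ∈ S :=
    ae_all_iff.2 fun i =>
      (measurePreserving_eval (fun _ : Fin n => μ) i).quasiMeasurePreserving.ae hS
  filter_upwards [hall] with x hx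
  rw [← hy, closure_pi_set]
  exact fun i _ => hSc (hx i)

variable {E : Type*} [NormedAddCommGroup E] [NormedSpace ℝ E] [MeasurableSpace E] [BorelSpace E]
  {n : ℕ}

/-- Dominated convergence along the smooth approximations. Negative `t` is covered by applying the
bound to `-F m`, and serves later to control means. -/
lemma LogSobolev.integral_exp_le_of_lip_of_bounded {μ : Measure E} [IsProbabilityMeasure μ] {C : ℝ}
    (hC : 0 ≤ C) (hμ : LogSobolev μ C) {y : ℕ → Fin n → E}
    (hy : ∀ᵐ x ∂(Measure.pi fun _ : Fin n => μ), x ∈ closure (Set.range y))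
    {L A : ℝ} (hL : 0 ≤ L) {G : (Fin n → E) → ℝ}
    (hG : ∀ x y, |G x - G y| ≤ L * ‖WithLp.toLp 2 (x - y)‖) (h0 : ∀ x, 0 ≤ G x)
    (hA : ∀ x, G x ≤ A) :
    AEMeasurable G (Measure.pi fun _ : Fin n => μ) ∧
    ∀ t : ℝ, ∫ x, Real.exp (t * G x) ∂(Measure.pi fun _ : Fin n => μ) ≤
      Real.exp (t * ∫ x, G x ∂(Measure.pi fun _ : Fin n => μ) + C / 2 * (t * L) ^ 2) := by
  obtain ⟨F, hF, hFA, hFG⟩ := exists_seq_smoothLip_tendsto hL hG h0 hA y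
  have hlim := hy.mono fun x hx => hFG x hx
  refine ⟨aemeasurable_of_tendsto_metrizable_ae' (fun m => (hF m).measurable.aemeasurable) hlim,
    fun t => ?_⟩
  have hbd : ∀ m x, |t * F m x| ≤ |t| * (A + 1) := fun m x => by
    rw [abs_mul]; exact mul_le_mul_of_nonneg_left (hFA m x) (abs_nonneg _)
  have hm : ∀ m, ∫ x, Real.exp (t * F m x) ∂(Measure.pi fun _ : Fin n => μ) ≤
      Real.exp (t * ∫ x, F m x ∂(Measure.pi fun _ : Fin n => μ) + C / 2 * (t * L) ^ 2) := by
    intro m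
    rw [← integral_const_mul]
    rcases le_total 0 t with ht | ht
    · exact ((hF m).const_mul ht).integral_exp_le (hbd m) hC hμ
    · have := ((hF m).neg.const_mul (neg_nonneg.2 ht)).integral_exp_le
        (B := |t| * (A + 1)) (fun x => by rw [neg_mul_neg]; exact hbd m x) hC hμ
      simpa only [neg_mul_neg, neg_mul t L, neg_sq] using this
  have l1 : Tendsto (fun m => ∫ x, Real.exp (t * F m x) ∂(Measure.pi fun _ : Fin n => μ)) atTop
      (𝓝 (∫ x, Real.exp (t * G x) ∂(Measure.pi fun _ : Fin n => μ))) := by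
    refine tendsto_integral_of_dominated_convergence (fun _ => Real.exp (|t| * (A + 1)))
      (fun m => ((hF m).measurable.const_mul t).exp.aestronglyMeasurable) (integrable_const _)
      (fun m => ae_of_all _ fun x => ?_) ?_
    · rw [Real.norm_eq_abs, Real.abs_exp]
      exact Real.exp_le_exp.2 ((le_abs_self _).trans (hbd m x))
    · filter_upwards [hlim] with x hx
      exact (Real.continuous_exp.tendsto _).comp (hx.const_mul t)
  have l2 : Tendsto (fun m => ∫ x, F m x ∂(Measure.pi fun _ : Fin n => μ)) atTop
      (𝓝 (∫ x, G x ∂(Measure.pi fun _ : Fin n => μ))) :=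
    tendsto_integral_of_dominated_convergence (fun _ => A + 1)
      (fun m => (hF m).measurable.aestronglyMeasurable) (integrable_const _)
      (fun m => ae_of_all _ fun x => hFA m x) hlim
  exact le_of_tendsto_of_tendsto' l1
    ((Real.continuous_exp.tendsto _).comp ((l2.const_mul t).add_const _)) hm

/-- A nonnegative Lipschitz function of an independent sample from a measure with a logarithmic
Sobolev inequality is integrable and sub-Gaussian around its mean. -/
lemma LogSobolev.hasSubgaussianMGF {μ : Measure E} [IsProbabilityMeasure μ] {C : ℝ}
    (hC : 0 ≤ C) (hμ : LogSobolev μ C) {y : ℕ → Fin n → E}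
    (hy : ∀ᵐ x ∂(Measure.pi fun _ : Fin n => μ), x ∈ closure (Set.range y))
    {L : ℝ} (hL : 0 ≤ L) {G : (Fin n → E) → ℝ}
    (hG : ∀ x y, |G x - G y| ≤ L * ‖WithLp.toLp 2 (x - y)‖) (h0 : ∀ x, 0 ≤ G x) :
    Integrable G (Measure.pi fun _ : Fin n => μ) ∧
    HasSubgaussianMGF (fun x => G x - ∫ x, G x ∂(Measure.pi fun _ : Fin n => μ))
      (C * L ^ 2).toNNReal (Measure.pi fun _ : Fin n => μ) := by
  set π := Measure.pi fun _ : Fin n => μ with hπ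
  set T : ℕ → (Fin n → E) → ℝ := fun k x => min (G x) k with hT
  have hT0 : ∀ k x, 0 ≤ T k x := fun k x => le_min (h0 x) (Nat.cast_nonneg k)
  have hTk : ∀ k x, T k x ≤ k := fun k x => min_le_right _ _
  have hTG : ∀ k x, T k x ≤ G x := fun k x => min_le_left _ _
  have hTL : ∀ k x y, |T k x - T k y| ≤ L * ‖WithLp.toLp 2 (x - y)‖ := fun k x y =>
    ((abs_min_sub_min_le_max _ _ _ _).trans (by simp)).trans (hG x y)
  have hTlim : ∀ x, Tendsto (fun k => T k x) atTop (𝓝 (G x)) := fun x => by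
    refine tendsto_const_nhds.congr' ?_
    filter_upwards [eventually_ge_atTop ⌈G x⌉₊] with k hk
    exact (min_eq_left (Nat.ceil_le.1 hk)).symm
  have main := fun k => hμ.integral_exp_le_of_lip_of_bounded hC hy hL (hTL k) (hT0 k) (hTk k)
  have hTm : ∀ k, AEMeasurable (T k) π := fun k => (main k).1
  have hGm : AEMeasurable G π :=
    aemeasurable_of_tendsto_metrizable_ae' hTm (ae_of_all _ hTlim)
  have hTi : ∀ k, Integrable (T k) π := fun k =>
    Integrable.of_bound (hTm k).aestronglyMeasurable k (ae_of_all _ fun x => by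
      rw [Real.norm_eq_abs, abs_of_nonneg (hT0 k x)]; exact hTk k x)
  have hexpi : ∀ t k, Integrable (fun x => Real.exp (t * T k x)) π := fun t k =>
    Integrable.of_bound ((hTm k).const_mul t).exp.aestronglyMeasurable (Real.exp (|t| * k))
      (ae_of_all _ fun x => by
        rw [Real.norm_eq_abs, Real.abs_exp]
        refine Real.exp_le_exp.2 ((le_abs_self _).trans ?_)
        rw [abs_mul, abs_of_nonneg (hT0 k x)]
        exact mul_le_mul_of_nonneg_left (hTk k x) (abs_nonneg _))
  have hGe : Integrable (fun x => Real.exp (-G x)) π :=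
    Integrable.of_bound hGm.neg.exp.aestronglyMeasurable 1 (ae_of_all _ fun x => by
      rw [Real.norm_eq_abs, Real.abs_exp, Real.exp_le_one_iff]
      linarith [h0 x])
  have hδ : 0 < ∫ x, Real.exp (-G x) ∂π := integral_exp_pos hGe
  -- Integrability of `G` is not assumed. The Laplace bound at `t = -1` bounds the means of the
  -- truncations uniformly, because the integral of `exp (-T k)` stays above the positive integral
  -- of `exp (-G)`.
  have hbound : ∀ k, ∫ x, T k x ∂π ≤ C / 2 * L ^ 2 - Real.log (∫ x, Real.exp (-G x) ∂π) := by
    intro k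
    have h1 := (main k).2 (-1)
    have h2 : ∫ x, Real.exp (-G x) ∂π ≤ ∫ x, Real.exp (-1 * T k x) ∂π :=
      integral_mono hGe (hexpi (-1) k) fun x => Real.exp_le_exp.2 (by linarith [hTG k x])
    have h3 := (Real.log_le_iff_le_exp hδ).2 (h2.trans h1)
    rw [neg_one_mul L, neg_sq] at h3
    linarith
  have hGi : Integrable G π := (integrable_and_integral_le_of_tendsto hT0 hTi hbound
    tendsto_const_nhds (ae_of_all _ hTlim)).1
  have hITlim : Tendsto (fun k => ∫ x, T k x ∂π) atTop (𝓝 (∫ x, G x ∂π)) :=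
    tendsto_integral_of_dominated_convergence G (fun k => (hTm k).aestronglyMeasurable) hGi
      (fun k => ae_of_all _ fun x => by
        rw [Real.norm_eq_abs, abs_of_nonneg (hT0 k x)]; exact hTG k x)
      (ae_of_all _ hTlim)
  have hexp : ∀ t : ℝ, Integrable (fun x => Real.exp (t * G x)) π ∧
      ∫ x, Real.exp (t * G x) ∂π ≤ Real.exp (t * ∫ x, G x ∂π + C / 2 * (t * L) ^ 2) := fun t =>
    integrable_and_integral_le_of_tendsto (fun k x => (Real.exp_pos _).le) (hexpi t)
      (fun k => (main k).2 t)
      ((Real.continuous_exp.tendsto _).comp ((hITlim.const_mul t).add_const _))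
      (ae_of_all _ fun x => (Real.continuous_exp.tendsto _).comp ((hTlim x).const_mul t))
  have hsplit : ∀ t x, Real.exp (t * (G x - ∫ x, G x ∂π))
      = Real.exp (t * G x) * Real.exp (-(t * ∫ x, G x ∂π)) := fun t x => by
    rw [← Real.exp_add]; congr 1; ring
  refine ⟨hGi, fun t => ?_, fun t => ?_⟩
  · simp_rw [hsplit]
    exact (hexp t).1.mul_const _
  · rw [mgf]
    simp_rw [hsplit]
    rw [integral_mul_const, Real.coe_toNNReal _ (by positivity)]
    refine (mul_le_mul_of_nonneg_right (hexp t).2 (Real.exp_pos _).le).trans (le_of_eq ?_)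
    rw [← Real.exp_add]
    congr 1
    ring

/-- Measures with a logarithmic Sobolev inequality have finite moments. -/
lemma LogSobolev.lintegral_enorm_sub_rpow_lt_top {μ : Measure E} [IsProbabilityMeasure μ] {C : ℝ}
    (hC : 0 ≤ C) (hμ : LogSobolev μ C)
    (hsep : ∃ S : Set E, TopologicalSpace.IsSeparable S ∧ ∀ᵐ x ∂μ, x ∈ S) {p : ℝ} (hp : 0 < p)
    (a : E) : ∫⁻ x, ‖a - x‖ₑ ^ p ∂μ < ∞ := by
  obtain ⟨y, hy⟩ := exists_seq_ae_mem_closure hsep 1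
  -- With a sample of size one, the norm distance to `a` is `1`-Lipschitz, and sub-Gaussian
  -- variables have all moments.
  obtain ⟨hi, hsub⟩ := hμ.hasSubgaussianMGF (n := 1) hC hy zero_le_one
    (G := fun x => ‖a - x 0‖) (fun x z => by
      have h1 := abs_norm_sub_norm_le (a - x 0) (a - z 0)
      have h2 : ‖WithLp.toLp 2 (x - z)‖ = ‖x 0 - z 0‖ := by
        rw [PiLp.norm_eq_of_L2]; simp
      rw [h2, one_mul]
      rwa [sub_sub_sub_cancel_left, norm_sub_rev (z 0)] at h1) fun x => norm_nonneg _
  have h1 := (hsub.memLp p.toNNReal).add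
    (memLp_const (∫ x, ‖a - x 0‖ ∂(Measure.pi fun _ : Fin 1 => μ)))
  have h2 : MemLp (fun x : Fin 1 → E => ‖a - x 0‖) p.toNNReal (Measure.pi fun _ : Fin 1 => μ) := by
    refine h1.congr_norm (hi.aestronglyMeasurable) (ae_of_all _ fun x => ?_)
    simp
  have h3 := lintegral_rpow_enorm_lt_top_of_eLpNorm_lt_top (by simpa using hp) (by simp) h2.2
  simp only [ENNReal.coe_toReal, Real.coe_toNNReal _ hp.le, enorm_norm] at h3
  have hmeas : Measurable fun x : E => ‖a - x‖ₑ ^ p :=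
    ((continuous_const.sub continuous_id).enorm.measurable).pow_const p
  rw [← (measurePreserving_eval (fun _ : Fin 1 => μ) 0).lintegral_comp hmeas]
  exact h3

end Concentration

/-! ### Lipschitz dependence of the Wasserstein distance on the sample. -/

section Wasserstein

lemma sum_rpow_le_rpow_sum {ι : Type*} (s : Finset ι) (b : ι → ℝ≥0∞) {r : ℝ} (hr : 1 ≤ r) :
    ∑ i ∈ s, b i ^ r ≤ (∑ i ∈ s, b i) ^ r := by
  classical
  induction s using Finset.induction_on with
  | empty => simp
  | insert i s hi ih =>
    rw [Finset.sum_insert hi, Finset.sum_insert hi]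
    exact (add_le_add le_rfl ih).trans (ENNReal.add_rpow_le_rpow_add _ _ hr)

/-- The source of `max 2 p`: for `p ≤ 2` power means increase with the exponent, and for `p ≥ 2` the
`ℓ^p` norm is at most the `ℓ²` norm. -/
lemma rpow_mean_le_mul_l2 {n : ℕ} (hn : 1 ≤ n) {p : ℝ} (hp : 1 ≤ p) (a : Fin n → ℝ≥0∞) :
    (∑ i, (n : ℝ≥0∞)⁻¹ * a i ^ p) ^ (1 / p) ≤
      ((n : ℝ≥0∞)⁻¹) ^ (1 / max 2 p) * (∑ i, a i ^ (2 : ℝ)) ^ (1 / (2 : ℝ)) := by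
  have hp0 : 0 < p := zero_lt_one.trans_le hp
  rcases le_total p 2 with h2 | h2
  · rw [max_eq_left h2, ← ENNReal.mul_rpow_of_nonneg _ _ (by norm_num), Finset.mul_sum]
    have hw : ∑ _i : Fin n, (n : ℝ≥0∞)⁻¹ = 1 := by
      simp only [Finset.sum_const, Finset.card_univ, Fintype.card_fin, nsmul_eq_mul]
      exact ENNReal.mul_inv_cancel (by simpa using Nat.one_le_iff_ne_zero.1 hn) (by simp)
    have key := ENNReal.rpow_arith_mean_le_arith_mean_rpow Finset.univ
      (fun _ : Fin n => (n : ℝ≥0∞)⁻¹) (fun i => a i ^ p) hw (p := 2 / p)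
      ((one_le_div hp0).2 h2)
    have he : ∀ i, (a i ^ p) ^ (2 / p) = a i ^ (2 : ℝ) := fun i => by
      rw [← ENNReal.rpow_mul]; congr 1; field_simp
    simp only [he] at key
    have h3 := ENNReal.rpow_le_rpow key (by norm_num : (0 : ℝ) ≤ 1 / 2)
    rwa [← ENNReal.rpow_mul, show 2 / p * (1 / 2) = 1 / p by field_simp] at h3
  · rw [max_eq_right h2, ← Finset.mul_sum, ENNReal.mul_rpow_of_nonneg _ _ (by positivity)]
    gcongr
    have key := sum_rpow_le_rpow_sum Finset.univ (fun i => a i ^ (2 : ℝ)) (r := p / 2) (by linarith)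
    have he : ∀ i, (a i ^ (2 : ℝ)) ^ (p / 2) = a i ^ p := fun i => by
      rw [← ENNReal.rpow_mul]; congr 1; field_simp
    simp only [he] at key
    have h3 := ENNReal.rpow_le_rpow key (by positivity : (0 : ℝ) ≤ 1 / p)
    rwa [← ENNReal.rpow_mul, show p / 2 * (1 / p) = 1 / 2 by field_simp] at h3

variable {E : Type*} [NormedAddCommGroup E] [MeasurableSpace E] [BorelSpace E] {n : ℕ}

lemma measurable_enorm_sub_rpow (a : E) (p : ℝ) : Measurable fun z : E => ‖a - z‖ₑ ^ p :=
  ((continuous_const.sub continuous_id).enorm.measurable).pow_const p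

/-- Cutting `μ` into pieces of mass `1 / n` and matching the `i`-th piece with `x i` is a coupling.
-/
lemma wasserstein_empiricalMeasure_le {μ : Measure E} (p : ℝ) (x : Fin n → E)
    {ν : Fin n → Measure E} (hν : ∀ i, ν i Set.univ = (n : ℝ≥0∞)⁻¹) (hsum : ∑ i, ν i = μ) :
    wasserstein p (empiricalMeasure x) μ ≤ (∑ i, ∫⁻ z, ‖x i - z‖ₑ ^ p ∂(ν i)) ^ (1 / p) := by
  have hc : IsCoupling (∑ i, (ν i).map (Prod.mk (x i))) (empiricalMeasure x) μ := by
    constructor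
    · ext B hB
      rw [Measure.map_apply measurable_fst hB, empiricalMeasure, Measure.smul_apply,
        Measure.finsetSum_apply, Measure.finsetSum_apply, smul_eq_mul, Finset.mul_sum]
      refine Finset.sum_congr rfl fun i _ => ?_
      rw [Measure.map_apply measurable_prodMk_left (measurable_fst hB), Measure.dirac_apply' _ hB]
      by_cases hx : x i ∈ B
      · simp [Set.preimage, hx, hν]
      · simp [Set.preimage, hx]
    · rw [← hsum]
      ext B hB
      rw [Measure.map_apply measurable_snd hB, Measure.finsetSum_apply, Measure.finsetSum_apply]
      refine Finset.sum_congr rfl fun i _ => ?_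
      rw [Measure.map_apply measurable_prodMk_left (measurable_snd hB)]
      rfl
  rw [wasserstein]
  refine le_trans (iInf₂_le (∑ i, (ν i).map (Prod.mk (x i))) hc) (le_of_eq ?_)
  rw [lintegral_finsetSum_measure]
  congr 1
  exact Finset.sum_congr rfl fun i _ => (measurableEmbedding_prodMk_left (x i)).lintegral_map _

/-- Conversely, every coupling arises from such a cutting, by restriction to the fibres over the
atoms. When sample points coincide, their fibre is shared equally, whence the multiplicity `m`. -/
lemma IsCoupling.exists_decomposition {μ : Measure E} {ξ : Measure (E × E)} {x : Fin n → E}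
    (hξ : IsCoupling ξ (empiricalMeasure x) μ) (p : ℝ) :
    ∃ ν : Fin n → Measure E, (∀ i, ν i Set.univ = (n : ℝ≥0∞)⁻¹) ∧ ∑ i, ν i = μ ∧
      ∑ i, ∫⁻ z, ‖x i - z‖ₑ ^ p ∂(ν i) = ∫⁻ z, ‖z.1 - z.2‖ₑ ^ p ∂ξ := by
  classical
  set m : E → ℕ := fun a => (Finset.univ.filter fun i => x i = a).card with hm
  have hm0 : ∀ i, (m (x i) : ℝ≥0∞) ≠ 0 := fun i => by
    simp [hm, Finset.filter_eq_empty_iff]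
  have hfib : ∀ a : E, MeasurableSet (Prod.fst ⁻¹' {a} : Set (E × E)) := fun a =>
    measurable_fst (measurableSet_singleton a)
  have hfst : ∀ a, ξ (Prod.fst ⁻¹' {a}) = (n : ℝ≥0∞)⁻¹ * m a := fun a => by
    rw [← Measure.map_apply measurable_fst (measurableSet_singleton a), hξ.1, empiricalMeasure,
      Measure.smul_apply, Measure.finsetSum_apply, smul_eq_mul]
    congr 1
    simp [hm, Set.indicator_apply]
  have hae : ∀ᵐ z ∂ξ, z ∈ ⋃ a ∈ Finset.univ.image x, (Prod.fst ⁻¹' {a} : Set (E × E)) := by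
    have h1 : ∀ᵐ a ∂(ξ.map Prod.fst), a ∈ ((Finset.univ.image x : Finset E) : Set E) := by
      rw [hξ.1, empiricalMeasure, ae_iff, Measure.smul_apply, Measure.finsetSum_apply]
      simp only [smul_eq_mul, mul_eq_zero]
      right
      refine Finset.sum_eq_zero fun i _ => ?_
      have hms : MeasurableSet {a | ¬ a ∈ ((Finset.univ.image x : Finset E) : Set E)} :=
        (Finset.measurableSet _).compl
      rw [Measure.dirac_apply' _ hms]
      simp
    filter_upwards [ae_of_ae_map measurable_fst.aemeasurable h1] with z hz
    simpa [eq_comm] using hz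
  -- No measurability of `f` is needed, which matters because the cost may fail to be measurable for
  -- the product `σ`-algebra; on each fibre it depends on the second coordinate only.
  have key : ∀ f : E × E → ℝ≥0∞,
      ∑ i, (m (x i) : ℝ≥0∞)⁻¹ * ∫⁻ z in Prod.fst ⁻¹' {x i}, f z ∂ξ = ∫⁻ z, f z ∂ξ := by
    intro f
    conv_rhs => rw [← Measure.restrict_eq_self_of_ae_mem hae]
    rw [lintegral_biUnion_finset (fun a _ b _ hab => ?_) (fun a _ => hfib a),
      Finset.sum_comp (fun a => (m a : ℝ≥0∞)⁻¹ * ∫⁻ z in Prod.fst ⁻¹' {a}, f z ∂ξ) x]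
    · refine Finset.sum_congr rfl fun a ha => ?_
      obtain ⟨i, -, rfl⟩ := Finset.mem_image.1 ha
      rw [nsmul_eq_mul, ← mul_assoc]
      change (m (x i) : ℝ≥0∞) * _ * _ = _
      rw [ENNReal.mul_inv_cancel (hm0 i) (by simp), one_mul]
    · exact Disjoint.preimage _ (Set.disjoint_singleton.2 hab)
  refine ⟨fun i => (m (x i) : ℝ≥0∞)⁻¹ • (ξ.restrict (Prod.fst ⁻¹' {x i})).map Prod.snd,
    fun i => ?_, ?_, ?_⟩
  · rw [Measure.smul_apply, Measure.map_apply measurable_snd MeasurableSet.univ, Set.preimage_univ,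
      Measure.restrict_apply_univ, hfst, smul_eq_mul, mul_left_comm,
      ENNReal.inv_mul_cancel (hm0 i) (by simp), mul_one]
  · rw [← hξ.2]
    ext B hB
    rw [Measure.finsetSum_apply, Measure.map_apply measurable_snd hB]
    have h1 := key ((Prod.snd ⁻¹' B).indicator 1)
    rw [lintegral_indicator_one (measurable_snd hB)] at h1
    rw [← h1]
    refine Finset.sum_congr rfl fun i _ => ?_
    rw [lintegral_indicator_one (measurable_snd hB), Measure.smul_apply,
      Measure.map_apply measurable_snd hB, smul_eq_mul]
  · rw [← key]
    refine Finset.sum_congr rfl fun i _ => ?_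
    rw [lintegral_smul_measure, smul_eq_mul,
      lintegral_map (measurable_enorm_sub_rpow _ _) measurable_snd]
    congr 1
    refine setLIntegral_congr_fun (hfib _) fun z hz => ?_
    have hz : z.1 = x i := hz
    simp only [hz]

/-- Minkowski's inequality in `L^p` of the disjoint union of the pieces, realized as a measure on
`Fin n × E`. -/
lemma lintegral_enorm_sub_decomposition_le {ν : Fin n → Measure E}
    (hν : ∀ i, ν i Set.univ = (n : ℝ≥0∞)⁻¹) {p : ℝ} (hp : 1 ≤ p) (x y : Fin n → E) :
    (∑ i, ∫⁻ z, ‖y i - z‖ₑ ^ p ∂(ν i)) ^ (1 / p) ≤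
      (∑ i, (n : ℝ≥0∞)⁻¹ * ‖y i - x i‖ₑ ^ p) ^ (1 / p)
        + (∑ i, ∫⁻ z, ‖x i - z‖ₑ ^ p ∂(ν i)) ^ (1 / p) := by
  set ρ : Measure (Fin n × E) := ∑ i, (ν i).map (Prod.mk i) with hρ
  have hint : ∀ g : Fin n × E → ℝ≥0∞, ∫⁻ w, g w ∂ρ = ∑ i, ∫⁻ z, g (i, z) ∂(ν i) := fun g => by
    rw [hρ, lintegral_finsetSum_measure]
    exact Finset.sum_congr rfl fun i _ => (measurableEmbedding_prodMk_left i).lintegral_map _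
  have hf : Measurable fun w : Fin n × E => ‖y w.1 - x w.1‖ₑ :=
    (measurable_of_countable fun i : Fin n => ‖y i - x i‖ₑ).comp measurable_fst
  have hg : Measurable fun w : Fin n × E => ‖x w.1 - w.2‖ₑ :=
    measurable_from_prod_countable_right fun i =>
      (show Continuous fun z : E => ‖x i - z‖ₑ by fun_prop).measurable
  have key := ENNReal.lintegral_Lp_add_le (μ := ρ) hf.aemeasurable hg.aemeasurable hp
  simp only [hint, Pi.add_apply, lintegral_const, hν] at key
  simp only [mul_comm _ (n : ℝ≥0∞)⁻¹] at key
  refine le_trans ?_ key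
  gcongr with i _ z
  calc ‖y i - z‖ₑ = ‖(y i - x i) + (x i - z)‖ₑ := by rw [sub_add_sub_cancel]
    _ ≤ _ := enorm_add_le _ _

/-- The pieces cut out by a coupling for `x` are reused for `y`, so no gluing of couplings is
required. -/
lemma wasserstein_empiricalMeasure_le_add {μ : Measure E} (hn : 1 ≤ n) {p : ℝ} (hp : 1 ≤ p)
    (x y : Fin n → E) :
    wasserstein p (empiricalMeasure y) μ ≤
      ((n : ℝ≥0∞)⁻¹) ^ (1 / max 2 p) * (∑ i, ‖y i - x i‖ₑ ^ (2 : ℝ)) ^ (1 / (2 : ℝ))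
        + wasserstein p (empiricalMeasure x) μ := by
  conv_rhs => rw [wasserstein]
  simp only [ENNReal.add_iInf]
  refine le_iInf₂ fun ξ hξ => ?_
  obtain ⟨ν, hν, hsum, hcost⟩ := hξ.exists_decomposition p
  rw [← hcost]
  exact (wasserstein_empiricalMeasure_le p y hν hsum).trans
    ((lintegral_enorm_sub_decomposition_le hν hp x y).trans
      (add_le_add (rpow_mean_le_mul_l2 hn hp _) le_rfl))

lemma wasserstein_empiricalMeasure_lt_top {μ : Measure E} [IsProbabilityMeasure μ] (hn : 1 ≤ n)
    {p : ℝ} (hp : 0 < p) (hμ : ∀ a : E, ∫⁻ z, ‖a - z‖ₑ ^ p ∂μ < ∞) (x : Fin n → E) :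
    wasserstein p (empiricalMeasure x) μ < ∞ := by
  have hn0 : (n : ℝ≥0∞) ≠ 0 := by simpa using Nat.one_le_iff_ne_zero.1 hn
  -- Equal pieces, that is, the independent coupling.
  refine (wasserstein_empiricalMeasure_le p x (ν := fun _ => (n : ℝ≥0∞)⁻¹ • μ) (by simp)
    ?_).trans_lt
    (ENNReal.rpow_lt_top_of_nonneg (by positivity) (ENNReal.sum_lt_top.2 fun i _ => ?_).ne)
  · ext B hB
    simp only [Finset.sum_const, Finset.card_univ, Fintype.card_fin, Measure.smul_apply,
      nsmul_eq_mul, smul_eq_mul]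
    rw [← mul_assoc, ENNReal.mul_inv_cancel hn0 (by simp), one_mul]
  · rw [lintegral_smul_measure]
    exact ENNReal.mul_lt_top (by simpa using Nat.pos_of_ne_zero (by lia)) (hμ _)

lemma abs_wasserstein_empiricalMeasure_sub_le {μ : Measure E} (hn : 1 ≤ n) {p : ℝ} (hp : 1 ≤ p)
    (hfin : ∀ x : Fin n → E, wasserstein p (empiricalMeasure x) μ < ∞) (x y : Fin n → E) :
    |(wasserstein p (empiricalMeasure x) μ).toReal
        - (wasserstein p (empiricalMeasure y) μ).toReal| ≤
      ((n : ℝ)⁻¹) ^ (1 / max 2 p) * ‖WithLp.toLp 2 (x - y)‖ := by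
  have hn0 : (0 : ℝ) < n := by exact_mod_cast hn
  have key : ∀ x y : Fin n → E, (wasserstein p (empiricalMeasure y) μ).toReal ≤
      ((n : ℝ)⁻¹) ^ (1 / max 2 p) * ‖WithLp.toLp 2 (y - x)‖
        + (wasserstein p (empiricalMeasure x) μ).toReal := by
    intro x y
    have h1 := wasserstein_empiricalMeasure_le_add (μ := μ) hn hp x y
    have h2 : ((n : ℝ≥0∞)⁻¹) ^ (1 / max 2 p) * (∑ i, ‖y i - x i‖ₑ ^ (2 : ℝ)) ^ (1 / (2 : ℝ))
        = ENNReal.ofReal (((n : ℝ)⁻¹) ^ (1 / max 2 p) * ‖WithLp.toLp 2 (y - x)‖) := by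
      rw [ENNReal.ofReal_mul (by positivity), ← ENNReal.ofReal_rpow_of_pos (by positivity),
        ENNReal.ofReal_inv_of_pos hn0, ENNReal.ofReal_natCast, PiLp.norm_eq_of_L2,
        Real.sqrt_eq_rpow, ← ENNReal.ofReal_rpow_of_nonneg (by positivity) (by norm_num),
        ENNReal.ofReal_sum_of_nonneg fun i _ => by positivity]
      congr 3
      ext i
      rw [← ofReal_norm, ENNReal.ofReal_rpow_of_nonneg (norm_nonneg _) (by norm_num)]
      simp
    rw [h2, ← ENNReal.ofReal_toReal (hfin x).ne, ← ENNReal.ofReal_add (by positivity)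
      ENNReal.toReal_nonneg] at h1
    exact ENNReal.toReal_le_of_le_ofReal (by positivity) h1
  have h1 := key y x
  have h2 := key x y
  rw [← neg_sub x y, WithLp.toLp_neg, norm_neg] at h2
  exact abs_sub_le_iff.2 ⟨by linarith, by linarith⟩

end Wasserstein

end EmpiricalWasserstein

/-! ### The deviation inequality for the empirical measure. -/

open EmpiricalWasserstein in
theorem mainTheorem7 {E : Type*} [NormedAddCommGroup E] [NormedSpace ℝ E] [CompleteSpace E]
    [MeasurableSpace E] [BorelSpace E]
    (μ : Measure E) [IsProbabilityMeasure μ]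
    (hsep : ∃ S : Set E, TopologicalSpace.IsSeparable S ∧ ∀ᵐ x ∂μ, x ∈ S)
    (C : ℝ) (hC : 0 < C) (hμ : EmpiricalWasserstein.LogSobolev μ C)
    (p : ℝ) (hp : 1 ≤ p) (n : ℕ) (hn : 1 ≤ n)
    {Ω : Type*} [MeasurableSpace Ω] (P : Measure Ω) [IsProbabilityMeasure P]
    (X : Fin n → Ω → E) (hlaw : ∀ i, HasLaw (X i) μ P) (hindep : iIndepFun X P) :
    let W : Ω → ℝ≥0∞ := fun ω =>
      EmpiricalWasserstein.wasserstein p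
        (EmpiricalWasserstein.empiricalMeasure fun i => X i ω) μ
    (∀ ω, W ω < ∞) ∧
    Integrable (fun ω => (W ω).toReal) P ∧
    ∀ t : ℝ, 0 ≤ t →
      P.real {ω | (W ω).toReal - ∫ ω', (W ω').toReal ∂P ≥ t}
        ≤ Real.exp (-((n : ℝ) ^ (2 / max 2 p) * t ^ 2 / (2 * C))) := by
  intro W
  have hn0 : (0 : ℝ) < n := by exact_mod_cast hn
  have hp0 : 0 < p := zero_lt_one.trans_le hp
  have hfin : ∀ x : Fin n → E, wasserstein p (empiricalMeasure x) μ < ∞ :=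
    wasserstein_empiricalMeasure_lt_top hn hp0 fun a =>
      hμ.lintegral_enorm_sub_rpow_lt_top hC.le hsep hp0 a
  set G : (Fin n → E) → ℝ := fun x => (wasserstein p (empiricalMeasure x) μ).toReal with hG
  obtain ⟨y, hy⟩ := exists_seq_ae_mem_closure hsep n
  obtain ⟨hGi, hsub⟩ := hμ.hasSubgaussianMGF hC.le hy
    (L := ((n : ℝ)⁻¹) ^ (1 / max 2 p)) (by positivity) (G := G)
    (abs_wasserstein_empiricalMeasure_sub_le hn hp hfin) fun x => ENNReal.toReal_nonneg
  have hXm : AEMeasurable (fun ω i => X i ω) P :=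
    aemeasurable_pi_lambda _ fun i => (hlaw i).aemeasurable
  have hmap : P.map (fun ω i => X i ω) = Measure.pi fun _ : Fin n => μ := by
    rw [(iIndepFun_iff_map_fun_eq_pi_map fun i => (hlaw i).aemeasurable).1 hindep]
    simp only [(hlaw _).map_eq]
  rw [← hmap] at hGi hsub
  have hmean : ∫ x, G x ∂(P.map fun ω i => X i ω) = ∫ ω, (W ω).toReal ∂P :=
    integral_map hXm hGi.aestronglyMeasurable
  refine ⟨fun ω => hfin _, hGi.comp_aemeasurable hXm, fun t ht => ?_⟩
  -- Chernoff's bound with variance proxy `C * L ^ 2`, where `L ^ 2 = n ^ (-2 / max 2 p)`.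
  have h1 := (hsub.of_map hXm).measure_ge_le ht
  rw [hmean] at h1
  refine h1.trans (le_of_eq ?_)
  rw [Real.coe_toNNReal _ (by positivity)]
  have hpow : (((n : ℝ)⁻¹) ^ (1 / max 2 p)) ^ 2 = ((n : ℝ) ^ (2 / max 2 p))⁻¹ := by
    rw [← Real.rpow_natCast, ← Real.rpow_mul (by positivity), Real.inv_rpow hn0.le]
    congr 2
    push_cast
    ring
  rw [hpow]
  congr 1
  have : (0 : ℝ) < (n : ℝ) ^ (2 / max 2 p) := by positivity
  field_simp
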